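/- **Setting.** Let $A=\mathbb Z[u_1,u_2,\dots]$ be the polynomial ring in independent commuting variables, with $u_0=1$ and $u_r=0$ for $r<0$. For $\alpha\in\mathbb Z^\ell$ put $u_\alpha=\prod_i u_{\alpha_i}$ and let $\psi:\mathbb Z[\mathbb Z^\ell]\to A$ be the $\mathbb Z$-linear map with $\psi(x^\alpha)=u_\alpha$. The Schur polynomial is $$U_\alpha=\prod_{i<j}(1-R_{ij})\,u_\alpha:=\psi\Big(\prod_{1\le i<j\le \ell}(1-x_ix_j^{-1})\,x^\alpha\Big),$$ where $R_{ij}$ is Young's raising operator (add $1$ to the $i$-th entry of the index and subtract $1$ from the $j$-th). For a partition $\lambda$ of length $\ell$, $u_\lambda$ and $U_\lambda$ are formed from $(\lambda_1,\dots,\lambda_\ell)\in\mathbb Z^\ell$. Let $v_0=1$ and $v_r=U_{(1^r)}$ for $r\ge1$, let $\omega:A\to A$ be the ring homomorphism with $\omega(u_r)=v_r$ for all $r$, and put $v_\lambda=\prod_i v_{\lambda_i}$ and $V_\lambda=\omega(U_\lambda)$. Let $K_{\lambda,\mu}$ be the Kostka number, i.e. the number of semistandard tableaux of shape $\lambda$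 and content $\mu$. For each $n$ the matrix $(K_{\lambda,\mu})_{|\lambda|=|\mu|=n}$ is invertible over $\mathbb Z$; let $t_\lambda\in A$ be the elements determined by $U_\lambda=\sum_{|\mu|=|\lambda|}K_{\lambda,\mu}\,t_\mu$ for all partitions $\lambda$. Let $\Lambda$ be the ring of symmetric functions over $\mathbb Z$ in infinitely many variables (symmetric formal power series of bounded degree), with monomial, complete and elementary symmetric functions $m_\lambda$, $h_r$, $e_r$, and put $h_\lambda=\prod_i h_{\lambda_i}$, $e_\lambda=\prod_i e_{\lambda_i}$. Let $\phi:A\to\Lambda$ be the ring homomorphism with $\phi(u_r)=h_r$ for $r\ge 1$, and let $s_\lambda=\phi(U_\lambda)$ be the Schur function. Write $\lambda'$ for the conjugate of $\lambda$. **Theorem (Cauchy identities).** 0. The Kostka numbers are also the coefficients in $u_\mu=\sum_{|\lambda|=|\mu|}K_{\lambda,\mu}\,U_\lambda$ for every partition $\mu$, and the transition equations $U_\lambda=\sum_{|\mu|=|\lambda|}K_{\lambda,\mu}\,t_\mu$ hold for every partition $\lambda$. 1. In $A\otimes_{\mathbb Z}A$, for every $n\ge0$, $$\sum_{|\lambda|=n}U_\lambda\otimes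 U_\lambda=\sum_{|\lambda|=n}t_\lambda\otimes u_\lambda .$$ 2. In $A\otimes_{\mathbb Z}A$, for every $n\ge0$, $$\sum_{|\lambda|=n}U_\lambda\otimes V_\lambda=\sum_{|\lambda|=n}t_\lambda\otimes v_\lambda .$$ 3. In $\mathbb Z[[x_1,x_2,\dots,y_1,y_2,\dots]]$, with sums over all partitions and products over all $i,j\ge1$, $$\sum_\lambda s_\lambda(x)s_\lambda(y)=\sum_\lambda m_\lambda(x)h_\lambda(y)=\prod_{i,j}\frac1{1-x_iy_j}.$$ 4. Likewise $$\sum_\lambda s_\lambda(x)s_{\lambda'}(y)=\sum_\lambda m_\lambda(x)e_\lambda(y)=\prod_{i,j}(1+x_iy_j).$$ In 3 and 4 the infinite sums and products converge (unconditionally) coefficient by coefficient. -/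

import Mathlib

open scoped TensorProduct MvPowerSeries.WithPiTopology

noncomputable section

namespace SchurCauchy

/-! Partitions are represented by their Young diagrams: the partition `lam` has parts
`lam.rowLen 0 ≥ lam.rowLen 1 ≥ ⋯`, its length (number of nonzero parts) is `lam.colLen 0`,
its size is `lam.card`, and its conjugate is `lam.transpose`. -/

/-! ### Partitions of a fixed integer -/

theorem finite_card_eq (n : ℕ) : {lam : YoungDiagram | lam.card = n}.Finite := by
  have hf : ((Finset.range n ×ˢ Finset.range n).powerset : Set (Finset (ℕ × ℕ))).Finite :=
    Finset.finite_toSet _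
  refine Set.Finite.of_finite_image (f := YoungDiagram.cells) (hf.subset ?_) ?_
  · rintro _ ⟨lam, hlam, rfl⟩
    change lam.card = n at hlam
    simp only [Finset.coe_powerset, Set.mem_preimage, Set.mem_powerset_iff, Finset.coe_subset]
    rintro ⟨i, j⟩ hc
    rw [YoungDiagram.mem_cells] at hc
    have h1 : i < lam.colLen j := YoungDiagram.mem_iff_lt_colLen.1 hc
    have h2 : j < lam.rowLen i := YoungDiagram.mem_iff_lt_rowLen.1 hc
    have h3 : lam.colLen j ≤ lam.card := by
      rw [YoungDiagram.colLen_eq_card]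
      exact Finset.card_le_card (Finset.filter_subset _ _)
    have h4 : lam.rowLen i ≤ lam.card := by
      rw [YoungDiagram.rowLen_eq_card]
      exact Finset.card_le_card (Finset.filter_subset _ _)
    simp only [Finset.mem_product, Finset.mem_range]
    omega
  · intro a _ b _ h
    exact YoungDiagram.ext h

/-- The finite set of all partitions of `n`. -/
def partitionsOf (n : ℕ) : Finset YoungDiagram := (finite_card_eq n).toFinset

@[simp]
theorem mem_partitionsOf {n : ℕ} {lam : YoungDiagram} :
    lam ∈ partitionsOf n ↔ lam.card = n := by
  simp [partitionsOf]

/-! ### The algebra `A = ℤ[u₁, u₂, …]` and its Schur polynomials -/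

/-- The polynomial ring `A = ℤ[u₁, u₂, …]`; the variable `X n` is `u_{n+1}`. -/
abbrev AlgA : Type := MvPolynomial ℕ ℤ

/-- `u_r` for `r ∈ ℤ`, with `u_0 = 1` and `u_r = 0` for `r < 0`. -/
def uInt (r : ℤ) : AlgA :=
  if r < 0 then 0 else if r = 0 then 1 else MvPolynomial.X (r.toNat - 1)

/-- `u_α = ∏ᵢ u_{αᵢ}` for an integer vector `α ∈ ℤ^ℓ`. -/
def uVec {l : ℕ} (a : Fin l → ℤ) : AlgA := ∏ i, uInt (a i)

/-- The `ℤ`-linear map `ψ : ℤ[ℤ^ℓ] → A` with `ψ(x^α) = u_α`. -/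
def psi (l : ℕ) : AddMonoidAlgebra ℤ (Fin l → ℤ) →ₗ[ℤ] AlgA :=
  (Finsupp.linearCombination ℤ (uVec (l := l))).comp
    (AddMonoidAlgebra.coeffLinearEquiv ℤ).toLinearMap

/-- Young's raising operator `R_{ij}`, which raises the `i`-th entry of an exponent by one and
lowers the `j`-th entry by one, as an element of the group algebra `ℤ[ℤ^ℓ]`
(acting on `ℤ[ℤ^ℓ]` by multiplication). -/
def raising {l : ℕ} (i j : Fin l) : AddMonoidAlgebra ℤ (Fin l → ℤ) :=
  AddMonoidAlgebra.single (Pi.single i 1 - Pi.single j 1) 1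

/-- The Schur polynomial `U_α = ∏_{i<j} (1 - R_{ij}) u_α` for `α ∈ ℤ^ℓ`. -/
def schurVec {l : ℕ} (a : Fin l → ℤ) : AlgA :=
  psi l ((∏ p : Fin l × Fin l with p.1 < p.2, (1 - raising p.1 p.2)) *
    AddMonoidAlgebra.single a 1)

/-- The parts of a partition `lam` of length `ℓ`, as a vector in `ℤ^ℓ`. -/
def partVec (lam : YoungDiagram) : Fin (lam.colLen 0) → ℤ := fun i => (lam.rowLen i : ℤ)

/-- The monomial `u_λ = ∏ᵢ u_{λᵢ}`. -/
def uPart (lam : YoungDiagram) : AlgA := uVec (partVec lam)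

/-- The Schur polynomial `U_λ`. -/
def schurU (lam : YoungDiagram) : AlgA := schurVec (partVec lam)

/-- `v_r = U_{(1^r)}` for `r ≥ 1`, `v_0 = 1` and `v_r = 0` for `r < 0`. -/
def vInt (r : ℤ) : AlgA :=
  if r < 0 then 0 else if r = 0 then 1 else schurVec (fun _ : Fin r.toNat => (1 : ℤ))

/-- The ring homomorphism `ω : A → A` with `ω(u_r) = v_r` for all `r`. -/
def omega : AlgA →ₐ[ℤ] AlgA := MvPolynomial.aeval fun n : ℕ => vInt (n + 1)

/-- `V_λ = ω(U_λ)`. -/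
def schurV (lam : YoungDiagram) : AlgA := omega (schurU lam)

/-- `v_λ = ∏ᵢ v_{λᵢ}`. -/
def vPart (lam : YoungDiagram) : AlgA := ∏ i, vInt (partVec lam i)

/-- The Kostka number `K_{λ,μ}`: the number of semistandard Young tableaux of shape `λ` and
content `μ`. (Entries of tableaux are natural numbers, so the entry `i` stands for `i + 1`.) -/
def kostka (lam mu : YoungDiagram) : ℕ :=
  Nat.card {T : SemistandardYoungTableau lam //
    ∀ i : ℕ, (lam.cells.filter fun c => T c.1 c.2 = i).card = mu.rowLen i}

/-- The Kostka matrix of the partitions of `n`. -/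
def kostkaMatrix (n : ℕ) : Matrix (partitionsOf n) (partitionsOf n) ℤ :=
  Matrix.of fun lam mu => (kostka lam mu : ℤ)

open Classical in
/-- The elements `t_λ` of `A` determined by `U_λ = ∑_μ K_{λ,μ} t_μ`, obtained by inverting the
Kostka matrix. -/
def tPart (lam : YoungDiagram) : AlgA :=
  ∑ mu : partitionsOf lam.card,
    (kostkaMatrix lam.card)⁻¹ ⟨lam, mem_partitionsOf.2 rfl⟩ mu • schurU mu

/-! ### The ring `Λ` of symmetric functions -/

/-- The ring `Λ` of symmetric functions in `x₁, x₂, …` over `ℤ`: the formal power series of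
bounded degree which are invariant under all permutations of the variables. -/
def Lam : Subring (MvPowerSeries ℕ ℤ) where
  carrier := {f | (∃ N : ℕ, ∀ d : ℕ →₀ ℕ, MvPowerSeries.coeff d f ≠ 0 → d.degree ≤ N) ∧
    ∀ s : Equiv.Perm ℕ, MvPowerSeries.rename s f = f}
  mul_mem' := by
    rintro f g ⟨⟨N, hN⟩, hf⟩ ⟨⟨M, hM⟩, hg⟩
    refine ⟨⟨N + M, fun d hd => ?_⟩, fun s => by rw [map_mul, hf, hg]⟩
    rw [MvPowerSeries.coeff_mul] at hd
    obtain ⟨p, hp, hne⟩ := Finset.exists_ne_zero_of_sum_ne_zero hd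
    rw [Finset.HasAntidiagonal.mem_antidiagonal] at hp
    rw [← hp, map_add]
    exact Nat.add_le_add (hN _ (left_ne_zero_of_mul hne)) (hM _ (right_ne_zero_of_mul hne))
  one_mem' := by
    refine ⟨⟨0, fun d hd => ?_⟩, fun s => map_one _⟩
    classical
    rw [MvPowerSeries.coeff_one] at hd
    have h0 : d = 0 := by
      by_contra h
      simp [h] at hd
    simp [h0]
  add_mem' := by
    rintro f g ⟨⟨N, hN⟩, hf⟩ ⟨⟨M, hM⟩, hg⟩
    refine ⟨⟨max N M, fun d hd => ?_⟩, fun s => by rw [map_add, hf, hg]⟩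
    by_cases h : MvPowerSeries.coeff d f = 0
    · have h' : MvPowerSeries.coeff d g ≠ 0 := by
        intro h'
        simp [h, h'] at hd
      exact (hM d h').trans (le_max_right _ _)
    · exact (hN d h).trans (le_max_left _ _)
  zero_mem' := ⟨⟨0, fun d hd => (hd (by simp)).elim⟩, fun s => map_zero _⟩
  neg_mem' := by
    rintro f ⟨⟨N, hN⟩, hf⟩
    refine ⟨⟨N, fun d hd => hN d ?_⟩, fun s => by rw [map_neg, hf]⟩
    intro h
    simp [h] at hd

/-- The power series `∑_α c_α x^α` with given coefficients. -/
def series (c : (ℕ →₀ ℕ) → ℤ) : MvPowerSeries ℕ ℤ := c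

@[simp]
theorem coeff_series (c : (ℕ →₀ ℕ) → ℤ) (d : ℕ →₀ ℕ) :
    MvPowerSeries.coeff d (series c) = c d := rfl

/-- A criterion for membership in `Λ` in terms of coefficients. -/
theorem series_mem_Lam {c : (ℕ →₀ ℕ) → ℤ} (N : ℕ)
    (hN : ∀ d : ℕ →₀ ℕ, c d ≠ 0 → d.degree ≤ N)
    (hs : ∀ (s : Equiv.Perm ℕ) (d : ℕ →₀ ℕ), c (d.equivMapDomain s) = c d) :
    series c ∈ Lam := by
  refine ⟨⟨N, hN⟩, fun s => ?_⟩
  ext d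
  have h : d = Finsupp.embDomain s.toEmbedding (d.equivMapDomain s.symm) := by
    rw [Finsupp.embDomain_eq_mapDomain]
    ext i
    obtain ⟨j, rfl⟩ := s.surjective i
    simp [Finsupp.mapDomain_apply s.injective]
  conv_lhs => rw [h]
  exact (MvPowerSeries.coeff_embDomain_rename s.toEmbedding (series c) _).trans (hs s.symm d)

theorem degree_equivMapDomain (s : Equiv.Perm ℕ) (d : ℕ →₀ ℕ) :
    (d.equivMapDomain s).degree = d.degree := by
  rw [Finsupp.equivMapDomain_eq_mapDomain, Finsupp.degree_mapDomain]

/-- The `r`-th complete symmetric function: the sum of all monomials of degree `r`. -/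
def hSym (r : ℕ) : Lam :=
  ⟨series fun d => if d.degree = r then 1 else 0, by
    refine series_mem_Lam r (fun d hd => ?_) (fun s d => ?_)
    · by_contra h
      exact hd (if_neg (by omega))
    · simp only [degree_equivMapDomain]⟩

open Classical in
/-- The `r`-th elementary symmetric function: the sum of all squarefree monomials of
degree `r`. -/
def eSym (r : ℕ) : Lam :=
  ⟨series fun d => if d.degree = r ∧ ∀ i, d i ≤ 1 then 1 else 0, by
    refine series_mem_Lam r (fun d hd => ?_) (fun s d => ?_)
    · by_contra h
      exact hd (if_neg (by omega))
    · have h : (∀ i, d.equivMapDomain s i ≤ 1) ↔ ∀ i, d i ≤ 1 := by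
        simp only [Finsupp.equivMapDomain_apply]
        exact s.symm.forall_congr_left.trans (by simp)
      simp only [degree_equivMapDomain, h]⟩

open Classical in
/-- The monomial symmetric function `m_λ`: the sum of the monomials `x^α` over all distinct
permutations `α` of `λ = (λ₁, λ₂, …)`. -/
def mSym (lam : YoungDiagram) : Lam :=
  ⟨series fun d => if ∃ s : Equiv.Perm ℕ, ∀ i, d (s i) = lam.rowLen i then 1 else 0, by
    refine series_mem_Lam (∑ᶠ i, lam.rowLen i) (fun d hd => ?_) (fun s d => ?_)
    · by_cases h : ∃ s : Equiv.Perm ℕ, ∀ i, d (s i) = lam.rowLen i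
      · obtain ⟨s, hs⟩ := h
        have h1 : d.degree = ∑ᶠ i, d i := by
          rw [Finsupp.degree_apply]
          exact (finsum_eq_sum_of_support_subset _ (by simp)).symm
        rw [h1, ← finsum_comp_equiv s (f := fun i => d i)]
        simp [hs]
      · exact (hd (if_neg h)).elim
    · have h : (∃ w : Equiv.Perm ℕ, ∀ i, d.equivMapDomain s (w i) = lam.rowLen i) ↔
          ∃ w : Equiv.Perm ℕ, ∀ i, d (w i) = lam.rowLen i := by
        constructor
        · rintro ⟨w, hw⟩
          exact ⟨w.trans s.symm, fun i => by simpa using hw i⟩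
        · rintro ⟨w, hw⟩
          exact ⟨w.trans s, fun i => by simpa using hw i⟩
      simp only [h]⟩

/-- `h_λ = ∏ᵢ h_{λᵢ}`. -/
def hPart (lam : YoungDiagram) : Lam := ∏ i ∈ Finset.range (lam.colLen 0), hSym (lam.rowLen i)

/-- `e_λ = ∏ᵢ e_{λᵢ}`. -/
def ePart (lam : YoungDiagram) : Lam := ∏ i ∈ Finset.range (lam.colLen 0), eSym (lam.rowLen i)

/-- The ring homomorphism `φ : A → Λ` with `φ(u_r) = h_r` for all `r ≥ 1`. -/
def phi : AlgA →ₐ[ℤ] Lam := MvPolynomial.aeval fun n : ℕ => hSym (n + 1)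

/-- The Schur function `s_λ = φ(U_λ)`. -/
def sSym (lam : YoungDiagram) : Lam := phi (schurU lam)

/-! ### Two sets of variables -/

/-- The ring `ℤ[[x₁, x₂, …, y₁, y₂, …]]`, which carries the topology of coefficientwise
convergence. -/
abbrev SeriesXY : Type := MvPowerSeries (ℕ ⊕ ℕ) ℤ

/-- `f ↦ f(x)`. -/
def inX (f : Lam) : SeriesXY :=
  MvPowerSeries.rename (Function.Embedding.inl : ℕ ↪ ℕ ⊕ ℕ) (f : MvPowerSeries ℕ ℤ)

/-- `f ↦ f(y)`. -/
def inY (f : Lam) : SeriesXY :=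
  MvPowerSeries.rename (Function.Embedding.inr : ℕ ↪ ℕ ⊕ ℕ) (f : MvPowerSeries ℕ ℤ)

/-- The monomial `x_i y_j`. -/
def xy (i j : ℕ) : SeriesXY := MvPowerSeries.X (Sum.inl i) * MvPowerSeries.X (Sum.inr j)

/-- The power series `1 / (1 - x_i y_j)`, the inverse of `1 - x_i y_j`, whose constant term
is `1`. -/
def cauchyFactor (i j : ℕ) : SeriesXY := MvPowerSeries.invOfUnit (1 - xy i j) 1

theorem mul_cauchyFactor (i j : ℕ) : (1 - xy i j) * cauchyFactor i j = 1 :=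
  MvPowerSeries.mul_invOfUnit _ _ (by simp [xy])

end SchurCauchy

end

open SchurCauchy

/-! Everything rests on horizontal strips. Multiplying ∏_{i<j}(1 - R_ij) by x^δ, where δ_j = j,
gives a Vandermonde determinant, so U_λ is the Jacobi–Trudi determinant of the u_{λ_i-i+j}
(`schurVec_eq_det`). Row and column operations on such determinants give two rules. The Pieri rule
(`uInt_mul_schurU`) writes u_p U_λ as the sum of the U_μ with μ/λ a horizontal strip of size p. The
branching rule (`map_schurU_branching`) says that adding one variable to the alphabet removes one
horizontal strip from λ.

Iterating Pieri, the coefficient of U_λ in u_α counts the chains of strips of sizes α_0, α_1, … from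
the empty diagram to λ (`prod_uInt_eq_sum`). Such chains are tableaux (`addStrip_bijective`), whence
the Kostka expansion of u_μ. Each U_λ is an integral combination of the linearly independent u_ν, so
the Kostka matrix is invertible over ℤ. The identities in A ⊗ A only move this matrix from one
tensor factor to the other; applying ω to the second factor gives the dual one.

Iterating branching, the coefficient of x^α in s_λ counts the same chains (`coeff_sSym`). Hence ∑_λ
s_λ(x) θ(U_λ)(y) = ∑_α x^α θ(u_α)(y) for every ring homomorphism θ : A → Λ, and sorting the
exponents α turns the right side into ∑_λ m_λ(x) θ(u_λ)(y). The choices θ = φ and θ = φ ∘ ω give the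
two identities for symmetric functions. For the second, φ(V_λ) = s_{λ'} (`phi_schurV`), because
vertical strips of λ are horizontal strips of λ'. The infinite products are compared with the series
one row at a time (`hasProd_of_rowSeries`). -/

namespace SchurCauchy

/-! ### Jacobi–Trudi determinants: branching and Pieri by row and column operations -/

section Determinants

variable {R : Type*} [CommRing R]

theorem det_of_last_row {n : ℕ} (M : Matrix (Fin (n + 1)) (Fin (n + 1)) R)
    (h : ∀ j : Fin n, M (Fin.last n) j.castSucc = 0) :
    M.det = M (Fin.last n) (Fin.last n) * (M.submatrix Fin.castSucc Fin.castSucc).det := by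
  rw [Matrix.det_succ_row M (Fin.last n), Fin.sum_univ_castSucc]
  simp [h, ← two_mul, Fin.succAbove_last]

theorem det_eq_of_forall_row_eq_smul_add_succ {n : ℕ}
    {A B : Matrix (Fin (n + 1)) (Fin (n + 1)) R} (c : Fin n → R)
    (hlast : ∀ j, A (Fin.last n) j = B (Fin.last n) j)
    (hcast : ∀ (i : Fin n) (j), A i.castSucc j = B i.castSucc j + c i * A i.succ j) :
    A.det = B.det := by
  rw [← Matrix.det_submatrix_equiv_self Fin.revPerm A,
    ← Matrix.det_submatrix_equiv_self Fin.revPerm B]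
  refine Matrix.det_eq_of_forall_row_eq_smul_add_pred (fun i => c i.rev) (fun j => ?_)
    (fun i j => ?_)
  · simpa using hlast j.rev
  · simpa [Fin.rev_succ, Fin.rev_castSucc] using hcast i.rev j.rev

theorem det_eq_of_forall_col_eq_smul_add_succ {n : ℕ}
    {A B : Matrix (Fin (n + 1)) (Fin (n + 1)) R} (c : Fin n → R)
    (hlast : ∀ i, A i (Fin.last n) = B i (Fin.last n))
    (hcast : ∀ (i) (j : Fin n), A i j.castSucc = B i j.castSucc + c j * A i j.succ) :
    A.det = B.det := by
  rw [← Matrix.det_transpose A, ← Matrix.det_transpose B]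
  exact det_eq_of_forall_row_eq_smul_add_succ c hlast fun i j => hcast j i

theorem det_sum_rows {n : ℕ} {ι : Type*} (S : Fin n → Finset ι) (c : Fin n → ι → R)
    (v : Fin n → ι → Fin n → R) :
    (Matrix.of fun i j => ∑ m ∈ S i, c i m * v i m j).det =
      ∑ r ∈ Fintype.piFinset S,
        (∏ i, c i (r i)) * (Matrix.of fun i j => v i (r i) j).det := by
  classical
  have h := (Matrix.detRowAlternating (R := R) (n := Fin n)).toMultilinearMap.map_sum_finset
    (fun i m => c i m • v i m) S
  have h1 : (Matrix.of fun i j => ∑ m ∈ S i, c i m * v i m j) =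
      fun i => ∑ m ∈ S i, c i m • v i m := by
    ext i j
    simp [Finset.sum_apply]
  rw [h1]
  refine h.trans (Finset.sum_congr rfl fun r _ => ?_)
  exact (Matrix.detRowAlternating (R := R) (n := Fin n)).toMultilinearMap.map_smul_univ _ _

/-- The Jacobi–Trudi determinant `det (g (f i - i + j))`. -/
def jacobiTrudi (g : ℤ → R) (N : ℕ) (f : ℕ → ℕ) : R :=
  (Matrix.of fun i j : Fin N => g ((f i : ℤ) - (i : ℤ) + (j : ℤ))).det

theorem jacobiTrudi_congr (g : ℤ → R) {N : ℕ} {f f' : ℕ → ℕ} (h : ∀ i < N, f i = f' i) :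
    jacobiTrudi g N f = jacobiTrudi g N f' := by
  unfold jacobiTrudi
  congr 2
  ext i j
  rw [h i i.2]

theorem map_jacobiTrudi {S F : Type*} [CommRing S] [FunLike F R S] [RingHomClass F R S] (φ : F)
    (g : ℤ → R) (N : ℕ) (f : ℕ → ℕ) :
    φ (jacobiTrudi g N f) = jacobiTrudi (fun r => φ (g r)) N f := by
  unfold jacobiTrudi
  have h := (φ : R →+* S).map_det
    (Matrix.of fun i j : Fin N => g ((f i : ℤ) - (i : ℤ) + (j : ℤ)))
  refine h.trans ?_
  congr 1

/-- A zero part makes the last row (0, …, 0, 1). Hence a Schur polynomial may be computed with any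
number of rows that is at least the length of the partition. -/
theorem jacobiTrudi_succ_of_eq_zero {g : ℤ → R} (hneg : ∀ r < 0, g r = 0) (h0 : g 0 = 1)
    {N : ℕ} {f : ℕ → ℕ} (hf : f N = 0) : jacobiTrudi g (N + 1) f = jacobiTrudi g N f := by
  unfold jacobiTrudi
  rw [det_of_last_row]
  · simp only [Matrix.of_apply, Fin.val_last, hf]
    rw [show ((0 : ℕ) : ℤ) - (N : ℤ) + (N : ℤ) = 0 by ring, h0, one_mul]
    rfl
  · intro j
    simp only [Matrix.of_apply, Fin.val_last, hf, Fin.val_castSucc]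
    apply hneg
    have := j.2
    lia

theorem jacobiTrudi_of_le {g : ℤ → R} (hneg : ∀ r < 0, g r = 0) (h0 : g 0 = 1)
    {N M : ℕ} (hNM : N ≤ M) {f : ℕ → ℕ} (hf : ∀ i, N ≤ i → f i = 0) :
    jacobiTrudi g M f = jacobiTrudi g N f := by
  induction M, hNM using Nat.le_induction with
  | base => rfl
  | succ M hM ih => rw [jacobiTrudi_succ_of_eq_zero hneg h0 (hf M hM), ih]

/-- Telescoping for sequences with `g' r = g r + z * g' (r - 1)`. -/
theorem sub_pow_mul_eq_sum {g g' : ℤ → R} {z : R} (h : ∀ r, g' r = g r + z * g' (r - 1))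
    (b : ℤ) (k : ℕ) :
    g' (b + k) = (∑ m ∈ Finset.range (k + 1), z ^ (k - m) * g (b + m)) + z ^ (k + 1) * g' (b - 1) := by
  induction k with
  | zero => simp [h b]
  | succ k ih =>
    rw [h, show b + ((k + 1 : ℕ) : ℤ) - 1 = b + k by push_cast; ring, ih,
      Finset.sum_range_succ _ (k + 1), mul_add, Finset.mul_sum, Nat.sub_self, pow_zero, one_mul]
    have : ∀ m ∈ Finset.range (k + 1), z * (z ^ (k - m) * g (b + m)) =
        z ^ (k + 1 - m) * g (b + m) := by
      intro m hm
      rw [Finset.mem_range] at hm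
      rw [← mul_assoc, ← pow_succ', show k - m + 1 = k + 1 - m by lia]
    rw [Finset.sum_congr rfl this]
    ring

/-- Branching of Jacobi–Trudi determinants along horizontal strips. -/
theorem jacobiTrudi_branching {g g' : ℤ → R} {z : R} (hneg : ∀ r < 0, g' r = 0) (h0 : g' 0 = 1)
    (h : ∀ r, g' r = g r + z * g' (r - 1)) {N : ℕ} {f : ℕ → ℕ} (hf : Antitone f) (hN : f N = 0) :
    jacobiTrudi g' N f =
      ∑ r ∈ Fintype.piFinset fun i : Fin N => Finset.Icc (f (i + 1)) (f i),
        (∏ i : Fin N, z ^ (f i - r i)) *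
          (Matrix.of fun i j : Fin N => g ((r i : ℤ) - (i : ℤ) + (j : ℤ))).det := by
  -- The appended zero part gives every row a successor. Subtracting `z ^ (f i - f (i + 1) + 1)`
  -- times row `i + 1` from row `i` cuts the expansion of `g'` in powers of `z` down to `f (i + 1) ≤
  -- m ≤ f i`. The interlacing bounds thus appear at once, with no further cancellation.
  rw [← jacobiTrudi_succ_of_eq_zero hneg h0 hN, jacobiTrudi]
  rw [det_eq_of_forall_row_eq_smul_add_succ
    (B := Matrix.of fun i j : Fin (N + 1) => if (i : ℕ) = N then
      g' ((f i : ℤ) - (i : ℤ) + (j : ℤ)) else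
      ∑ m ∈ Finset.Icc (f (i + 1)) (f i), z ^ (f i - m) * g ((m : ℤ) - (i : ℤ) + (j : ℤ)))
    (fun i => z ^ (f i - f (i + 1) + 1))]
  · rw [det_of_last_row]
    · simp only [Matrix.of_apply, Fin.val_last, hN, if_true]
      rw [show ((0 : ℕ) : ℤ) - (N : ℤ) + (N : ℤ) = 0 by ring, h0, one_mul]
      refine Eq.trans ?_ (det_sum_rows _ (fun (i : Fin N) m => z ^ (f i - m))
        (fun i m j => g ((m : ℤ) - (i : ℤ) + (j : ℤ))))
      congr 1
      ext i j
      simp [i.2.ne]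
    · intro j
      simp only [Matrix.of_apply, Fin.val_last, hN, Fin.val_castSucc, if_true]
      apply hneg
      have := j.2
      lia
  · intro j
    simp
  · intro i j
    simp only [Matrix.of_apply, Fin.val_castSucc, i.2.ne, if_false, Fin.val_succ]
    have hle : f (i + 1) ≤ f i := hf (Nat.le_succ _)
    obtain ⟨k, hk⟩ := Nat.exists_eq_add_of_le hle
    have := sub_pow_mul_eq_sum h ((f (i + 1) : ℤ) - i + j) k
    rw [show (f i : ℤ) - i + j = (f (i + 1) : ℤ) - i + j + k by rw [hk]; push_cast; ring, this,
      show f i - f (i + 1) = k by lia]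
    congr 1
    · rw [show Finset.Icc (f (i + 1)) (f i) = (Finset.range (k + 1)).map
        (addLeftEmbedding (f (i + 1))) by
          ext m
          simp only [Finset.mem_Icc, Finset.mem_map, Finset.mem_range, addLeftEmbedding_apply]
          constructor
          · intro hm
            exact ⟨m - f (i + 1), by lia, by lia⟩
          · rintro ⟨a, ha, rfl⟩
            lia]
      rw [Finset.sum_map]
      refine Finset.sum_congr rfl fun m _ => ?_
      simp only [addLeftEmbedding_apply]
      congr 2
      · lia
      · push_cast; ring
    · congr 2
      push_cast; ring

/-- Branching of Jacobi–Trudi determinants along vertical strips. -/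
theorem jacobiTrudi_branching_vertical {g g' : ℤ → R} {z : R}
    (h : ∀ r, g' r = g r + z * g (r - 1)) {N : ℕ} {f : ℕ → ℕ} (hf : ∀ i < N, 1 ≤ f i) :
    jacobiTrudi g' N f =
      ∑ r ∈ Fintype.piFinset fun i : Fin N => Finset.Icc (f i - 1) (f i),
        (∏ i : Fin N, z ^ (f i - r i)) *
          (Matrix.of fun i j : Fin N => g ((r i : ℤ) - (i : ℤ) + (j : ℤ))).det := by
  refine Eq.trans ?_ (det_sum_rows _ (fun (i : Fin N) m => z ^ (f i - m))
    (fun i m j => g ((m : ℤ) - (i : ℤ) + (j : ℤ))))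
  unfold jacobiTrudi
  congr 2
  ext i j
  obtain ⟨k, hk⟩ := Nat.exists_eq_add_of_le' (hf i i.2)
  rw [hk, h, Nat.add_sub_cancel, Finset.sum_Icc_succ_top (by lia), Finset.Icc_self,
    Finset.sum_singleton]
  simp only [Nat.add_sub_cancel_left, Nat.sub_self, pow_one, pow_zero, one_mul]
  rw [add_comm]
  congr 3
  push_cast; ring

/-- If `r i < r (i + 1)`, then `r (i + 1) ≤ f (i + 1) ≤ f i ≤ r i + 1` forces `r (i + 1) = r i + 1`,
and rows `i` and `i + 1` coincide. This removes the terms of the vertical branching that are not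
partitions. -/
theorem det_eq_zero_of_not_antitone (g : ℤ → R) {N : ℕ} {f : ℕ → ℕ} (hf : Antitone f)
    {r : Fin N → ℕ} (hr : ∀ i : Fin N, r i ∈ Finset.Icc (f i - 1) (f i)) (hanti : ¬ Antitone r) :
    (Matrix.of fun i j : Fin N => g ((r i : ℤ) - (i : ℤ) + (j : ℤ))).det = 0 := by
  cases N with
  | zero => exact (hanti fun i => i.elim0).elim
  | succ N =>
    rw [Fin.antitone_iff_succ_le] at hanti
    push Not at hanti
    obtain ⟨i, hi⟩ := hanti
    refine Matrix.det_zero_of_row_eq (i := i.castSucc) (j := i.succ) Fin.castSucc_lt_succ.ne ?_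
    have h1 := hr i.castSucc
    have h2 := hr i.succ
    have h3 : f (i + 1) ≤ f i := hf (Nat.le_succ _)
    simp only [Fin.val_castSucc, Fin.val_succ, Finset.mem_Icc] at h1 h2
    ext j
    simp only [Matrix.of_apply, Fin.val_castSucc, Fin.val_succ]
    congr 1
    lia

/-- The Pieri rule for Jacobi–Trudi determinants, in a ring with a nilpotent parameter `z`. -/
theorem jacobiTrudi_pieri {g : ℤ → R} {z : R} {p : ℕ} (hz : z ^ (p + 1) = 0)
    (hneg : ∀ r < 0, g r = 0) {N : ℕ} {f : ℕ → ℕ} (hf : Antitone f) (hN : f N = 0) :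
    (∑ k ∈ Finset.range (p + 1), z ^ k * g k) * jacobiTrudi g N f =
      ∑ r ∈ Fintype.piFinset fun i : Fin (N + 1) =>
          Finset.Icc (f i) (if (i : ℕ) = 0 then f 0 + p else f (i - 1)),
        (∏ i, z ^ (r i - f i)) *
          (Matrix.of fun i j : Fin (N + 1) => g ((r i : ℤ) - (i : ℤ) + (j : ℤ))).det := by
  -- The determinant of the `F (f i - i + j)` is evaluated twice, by column operations and by row
  -- operations. Nilpotency of `z` makes the recursion `F b = g b + z * F (b + 1)` exact although
  -- the sum is finite.
  set F : ℤ → R := fun b => ∑ k ∈ Finset.range (p + 1), z ^ k * g (b + k) with hF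
  have hFsucc : ∀ b, F b = g b + z * F (b + 1) := by
    intro b
    simp only [hF]
    rw [Finset.sum_range_succ', Finset.sum_range_succ (fun k => z ^ k * g (b + 1 + k)), mul_add,
      ← mul_assoc z, ← pow_succ', hz, zero_mul, add_zero, Finset.mul_sum, add_comm]
    congr 1
    · simp
    · refine Finset.sum_congr rfl fun k _ => ?_
      rw [← mul_assoc, ← pow_succ']
      congr 2
      push_cast; ring
  have hFk : ∀ (b : ℤ) (k : ℕ), F b =
      (∑ m ∈ Finset.range k, z ^ m * g (b + m)) + z ^ k * F (b + k) := by
    intro b k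
    induction k with
    | zero => simp
    | succ k ih =>
      rw [ih, Finset.sum_range_succ, hFsucc (b + k), mul_add, ← mul_assoc, ← pow_succ, ← add_assoc]
      congr 3
      push_cast; ring
  have hdet1 : (Matrix.of fun i j : Fin (N + 1) => F ((f i : ℤ) - (i : ℤ) + (j : ℤ))).det =
      (∑ k ∈ Finset.range (p + 1), z ^ k * g k) * jacobiTrudi g N f := by
    -- Subtracting `z` times the next column turns `F` into `g` except in the last column. As `f N =
    -- 0`, the last row becomes (0, …, 0, F 0), and `F 0` is the sum on the left-hand side.
    rw [det_eq_of_forall_col_eq_smul_add_succ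
      (B := Matrix.of fun i j : Fin (N + 1) => if (j : ℕ) = N then
        F ((f i : ℤ) - (i : ℤ) + (j : ℤ)) else g ((f i : ℤ) - (i : ℤ) + (j : ℤ)))
      (fun _ => z)]
    · rw [det_of_last_row]
      · congr 1
        · simp [hF, hN]
        · rw [jacobiTrudi]
          congr 1
          ext i j
          simp [j.2.ne]
      · intro j
        simp only [Matrix.of_apply, Fin.val_last, hN, Fin.val_castSucc, j.2.ne, if_false]
        apply hneg
        have := j.2
        lia
    · intro i
      simp
    · intro i j
      simp only [Matrix.of_apply, Fin.val_castSucc, j.2.ne, if_false, Fin.val_succ]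
      rw [hFsucc]
      congr 3
      push_cast; ring
  have hIcc : ∀ (a k : ℕ) (c : ℕ → R),
      ∑ m ∈ Finset.Icc a (a + k), c m = ∑ m ∈ Finset.range (k + 1), c (a + m) := by
    intro a k c
    rw [← Finset.Ico_add_one_right_eq_Icc, Finset.sum_Ico_eq_sum_range,
      show a + k + 1 - a = k + 1 by lia]
  rw [← hdet1]
  refine Eq.trans ?_ (det_sum_rows _ (fun (i : Fin (N + 1)) m => z ^ (m - f i))
    (fun i m j => g ((m : ℤ) - (i : ℤ) + (j : ℤ))))
  -- Subtracting a multiple of row `i` from row `i + 1` stops the sum at `m = f i`. The first row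
  -- has no predecessor and keeps its full length `p`.
  refine Matrix.det_eq_of_forall_row_eq_smul_add_pred
    (fun i => z ^ (f i - f (i + 1) + 1)) (fun j => ?_) (fun i j => ?_)
  · simp only [Matrix.of_apply, Fin.val_zero, if_true, hIcc]
    simp only [hF]
    refine Finset.sum_congr rfl fun k _ => ?_
    rw [Nat.add_sub_cancel_left]
    congr 2
    push_cast; ring
  · simp only [Matrix.of_apply, Fin.val_succ, Fin.val_castSucc, Nat.add_sub_cancel,
      Nat.succ_ne_zero, if_false]
    have hle : f (i + 1) ≤ f i := hf (Nat.le_succ _)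
    obtain ⟨k, hk⟩ := Nat.exists_eq_add_of_le hle
    rw [hFk _ (k + 1), hk, hIcc, Nat.add_sub_cancel_left]
    congr 1
    · refine Finset.sum_congr rfl fun k _ => ?_
      rw [Nat.add_sub_cancel_left]
      congr 2
      push_cast; ring
    · congr 2
      push_cast; ring

end Determinants

/-! ### From raising operators to the Jacobi–Trudi formula -/

section RaisingOperators

theorem addMonoidAlgebra_single_sum {M ι : Type*} [AddCommMonoid M] (s : Finset ι) (m : ι → M) :
    (AddMonoidAlgebra.single (∑ i ∈ s, m i) 1 : AddMonoidAlgebra ℤ M) =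
      ∏ i ∈ s, AddMonoidAlgebra.single (m i) 1 := by
  simp

/-- Since `x^δ` is the product of the `x_j` over all pairs `i < j`, each factor `1 - R_ij` can
absorb one `x_j` and becomes `x_j - x_i`. The result is a Vandermonde determinant, expanded by the
Leibniz formula. -/
theorem prod_one_sub_raising_mul (l : ℕ) :
    (∏ p : Fin l × Fin l with p.1 < p.2, (1 - raising p.1 p.2)) *
        (AddMonoidAlgebra.single (fun j : Fin l => (j : ℤ)) 1 : AddMonoidAlgebra ℤ (Fin l → ℤ)) =
      ∑ σ : Equiv.Perm (Fin l), (Equiv.Perm.sign σ : ℤ) •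
        AddMonoidAlgebra.single (fun i : Fin l => ((σ i : Fin l) : ℤ)) 1 := by
  classical
  set x : Fin l → AddMonoidAlgebra ℤ (Fin l → ℤ) :=
    fun i => AddMonoidAlgebra.single (Pi.single i 1) 1 with hx
  have h1 : (fun j : Fin l => (j : ℤ)) =
      ∑ p : Fin l × Fin l with p.1 < p.2, (Pi.single p.2 1 : Fin l → ℤ) := by
    ext j
    rw [Finset.sum_apply, Finset.sum_filter, Fintype.sum_prod_type]
    have : ∀ i : Fin l, (∑ k, if (i, k).1 < (i, k).2 then (Pi.single (i, k).2 1 : Fin l → ℤ) j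
        else 0) = if i < j then 1 else 0 := by
      intro i
      rw [Finset.sum_eq_single j]
      · simp
      · intro k _ hk
        simp [Pi.single_eq_of_ne hk.symm]
      · simp
    simp only [this]
    rw [← Finset.sum_filter, Finset.sum_const, Finset.filter_gt_eq_Iio, Fin.card_Iio]
    simp
  have h2 : (∏ p : Fin l × Fin l with p.1 < p.2, (1 - raising p.1 p.2)) *
      (AddMonoidAlgebra.single (fun j : Fin l => (j : ℤ)) 1 : AddMonoidAlgebra ℤ (Fin l → ℤ)) =
      (Matrix.vandermonde x).det := by
    rw [h1, addMonoidAlgebra_single_sum, ← Finset.prod_mul_distrib, Matrix.det_vandermonde,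
      Finset.prod_filter, Fintype.prod_prod_type]
    refine Finset.prod_congr rfl fun i _ => ?_
    rw [← Finset.prod_filter, Finset.filter_lt_eq_Ioi]
    refine Finset.prod_congr rfl fun j _ => ?_
    simp only [raising, hx, sub_mul, one_mul, AddMonoidAlgebra.single_mul_single]
    simp
  rw [h2, ← Matrix.det_transpose, Matrix.det_apply]
  refine Finset.sum_congr rfl fun σ _ => ?_
  rw [Units.smul_def]
  congr 1
  simp only [Matrix.transpose_apply, Matrix.vandermonde_apply, hx, AddMonoidAlgebra.single_pow,
    one_pow]
  rw [← addMonoidAlgebra_single_sum]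
  congr 1
  ext j
  rw [Finset.sum_apply, Finset.sum_eq_single j]
  · simp
  · intro k _ hk
    simp [Pi.single_eq_of_ne hk.symm]
  · simp

theorem psi_single {l : ℕ} (a : Fin l → ℤ) : psi l (AddMonoidAlgebra.single a 1) = uVec a := by
  simp [psi]

/-- As `psi` is linear but not multiplicative, the product must be expanded inside the group algebra
first. Writing `x^a = x^δ x^(a-δ)` brings in the Vandermonde expansion. -/
theorem schurVec_eq_sum {l : ℕ} (a : Fin l → ℤ) :
    schurVec a = ∑ σ : Equiv.Perm (Fin l), (Equiv.Perm.sign σ : ℤ) •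
      uVec fun i => a i - (i : ℤ) + ((σ i : Fin l) : ℤ) := by
  have h : (AddMonoidAlgebra.single a 1 : AddMonoidAlgebra ℤ (Fin l → ℤ)) =
      AddMonoidAlgebra.single (fun j : Fin l => (j : ℤ)) 1 *
        AddMonoidAlgebra.single (fun j : Fin l => a j - (j : ℤ)) 1 := by
    rw [AddMonoidAlgebra.single_mul_single, one_mul]
    congr 1
    ext j
    simp
  rw [schurVec, h, ← mul_assoc, prod_one_sub_raising_mul, Finset.sum_mul, map_sum]
  refine Finset.sum_congr rfl fun σ _ => ?_
  rw [smul_mul_assoc, map_smul, AddMonoidAlgebra.single_mul_single, one_mul, psi_single]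
  congr 2
  ext i
  simp only [Pi.add_apply]
  ring

theorem schurVec_eq_det {l : ℕ} (a : Fin l → ℤ) :
    schurVec a = (Matrix.of fun i j : Fin l => uInt (a i - (i : ℤ) + (j : ℤ))).det := by
  rw [schurVec_eq_sum, ← Matrix.det_transpose, Matrix.det_apply]
  refine Finset.sum_congr rfl fun σ _ => ?_
  rw [Units.smul_def]
  rfl

theorem uInt_of_neg {r : ℤ} (h : r < 0) : uInt r = 0 := if_pos h

@[simp]
theorem uInt_zero : uInt 0 = 1 := by simp [uInt]

theorem uInt_succ (n : ℕ) : uInt (n + 1) = MvPolynomial.X n := by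
  rw [uInt, if_neg (by lia), if_neg (by lia)]
  congr 1

end RaisingOperators

/-! ### Young diagrams through row lengths; horizontal and vertical strips -/

section Diagrams

theorem mem_iff_lt_rowLen {lam : YoungDiagram} {c : ℕ × ℕ} : c ∈ lam ↔ c.2 < lam.rowLen c.1 :=
  YoungDiagram.mem_iff_lt_rowLen

theorem rowLen_injective {lam mu : YoungDiagram} (h : ∀ i, lam.rowLen i = mu.rowLen i) :
    lam = mu := by
  ext c
  rw [YoungDiagram.mem_cells, YoungDiagram.mem_cells, mem_iff_lt_rowLen, mem_iff_lt_rowLen, h]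

theorem antitone_rowLen (lam : YoungDiagram) : Antitone lam.rowLen :=
  fun i j h => lam.rowLen_anti i j h

theorem rowLen_eq_zero_iff {lam : YoungDiagram} {i : ℕ} :
    lam.rowLen i = 0 ↔ lam.colLen 0 ≤ i := by
  rw [← not_lt, ← YoungDiagram.mem_iff_lt_colLen, YoungDiagram.mem_iff_lt_rowLen]
  lia

theorem le_iff_rowLen_le {lam mu : YoungDiagram} :
    lam ≤ mu ↔ ∀ i, lam.rowLen i ≤ mu.rowLen i := by
  constructor
  · intro h i
    by_contra! hlt
    exact lt_irrefl _ (YoungDiagram.mem_iff_lt_rowLen.1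
      (h (YoungDiagram.mem_iff_lt_rowLen.2 hlt : (i, mu.rowLen i) ∈ lam)))
  · intro h c hc
    exact mem_iff_lt_rowLen.2 ((mem_iff_lt_rowLen.1 hc).trans_le (h _))

theorem exists_rowLen_eq {f : ℕ → ℕ} (hf : Antitone f) {N : ℕ} (hN : f N = 0) :
    ∃ lam : YoungDiagram, ∀ i, lam.rowLen i = f i := by
  have hmem : ∀ c : ℕ × ℕ, c ∈ (Finset.range N ×ˢ Finset.range (f 0)).filter
      (fun c => c.2 < f c.1) ↔ c.2 < f c.1 := by
    intro c
    simp only [Finset.mem_filter, Finset.mem_product, Finset.mem_range, and_iff_right_iff_imp]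
    intro hc
    refine ⟨?_, hc.trans_le (hf (Nat.zero_le _))⟩
    by_contra! h
    have := hf h
    lia
  have hlow : IsLowerSet (((Finset.range N ×ˢ Finset.range (f 0)).filter
      (fun c => c.2 < f c.1) : Finset (ℕ × ℕ)) : Set (ℕ × ℕ)) := by
    intro a b hba ha
    rw [Finset.mem_coe, hmem] at ha ⊢
    exact (hba.2.trans_lt ha).trans_le (hf hba.1)
  refine ⟨⟨_, hlow⟩, fun i => eq_of_forall_lt_iff fun j => ?_⟩
  rw [← YoungDiagram.mem_iff_lt_rowLen]
  exact hmem (i, j)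

theorem card_eq_sum_rowLen {lam : YoungDiagram} {N : ℕ} (hN : lam.rowLen N = 0) :
    lam.card = ∑ i ∈ Finset.range N, lam.rowLen i := by
  rw [YoungDiagram.card, Finset.card_eq_sum_card_fiberwise (f := Prod.fst) (t := Finset.range N)]
  · refine Finset.sum_congr rfl fun i _ => ?_
    rw [YoungDiagram.rowLen_eq_card]
    rfl
  · intro c hc
    rw [Finset.mem_coe, YoungDiagram.mem_cells, mem_iff_lt_rowLen] at hc
    rw [Finset.mem_coe, Finset.mem_range]
    by_contra! h
    have := antitone_rowLen lam h
    lia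

theorem card_transpose (lam : YoungDiagram) : lam.transpose.card = lam.card := by
  refine Finset.card_bij' (fun c _ => c.swap) (fun c _ => c.swap) ?_ ?_ ?_ ?_ <;> simp

theorem schurU_eq_jacobiTrudi {lam : YoungDiagram} {N : ℕ} (hN : lam.rowLen N = 0) :
    schurU lam = jacobiTrudi uInt N lam.rowLen := by
  rw [jacobiTrudi_of_le (fun r => uInt_of_neg) uInt_zero (rowLen_eq_zero_iff.1 hN)
    (fun i => rowLen_eq_zero_iff.2), schurU, schurVec_eq_det]
  rfl

theorem map_schurU {R F : Type*} [CommRing R] [FunLike F AlgA R] [RingHomClass F AlgA R] (φ : F)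
    {lam : YoungDiagram} {N : ℕ} (hN : lam.rowLen N = 0) :
    φ (schurU lam) = jacobiTrudi (fun r => φ (uInt r)) N lam.rowLen := by
  rw [schurU_eq_jacobiTrudi hN, map_jacobiTrudi]

/-- `lam / nu` is a horizontal strip. -/
def IsStrip (nu lam : YoungDiagram) : Prop :=
  nu ≤ lam ∧ ∀ i j, (i + 1, j) ∈ lam → (i, j) ∈ nu

theorem isStrip_iff {nu lam : YoungDiagram} :
    IsStrip nu lam ↔ ∀ i, nu.rowLen i ≤ lam.rowLen i ∧ lam.rowLen (i + 1) ≤ nu.rowLen i := by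
  rw [IsStrip, le_iff_rowLen_le, forall_and]
  refine and_congr_right fun _ => forall_congr' fun i => ?_
  simp only [YoungDiagram.mem_iff_lt_rowLen]
  exact ⟨fun h => le_of_forall_lt h, fun h j hj => hj.trans_le h⟩

/-- Conjugation turns horizontal strips into vertical ones, which have at most one cell in each row.
-/
theorem isStrip_transpose_iff {nu lam : YoungDiagram} :
    IsStrip nu.transpose lam.transpose ↔
      ∀ i, nu.rowLen i ≤ lam.rowLen i ∧ lam.rowLen i - 1 ≤ nu.rowLen i := by
  rw [IsStrip, YoungDiagram.transpose_le_iff, le_iff_rowLen_le, forall_and]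
  refine and_congr_right fun _ => ?_
  simp only [YoungDiagram.mem_iff_lt_rowLen, YoungDiagram.rowLen_transpose,
    ← YoungDiagram.mem_iff_lt_colLen]
  constructor
  · intro h i
    by_contra! hlt
    have := h (nu.rowLen i) i (by lia)
    lia
  · intro h j i hj
    have := h i
    lia

open Classical in
/-- The diagrams `nu` such that `lam / nu` is a horizontal strip. -/
noncomputable def stripsBelow (lam : YoungDiagram) : Finset YoungDiagram :=
  ((Finset.range (lam.card + 1)).biUnion partitionsOf).filter fun nu => IsStrip nu lam

theorem card_le_card_of_le {nu lam : YoungDiagram} (h : nu ≤ lam) : nu.card ≤ lam.card :=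
  Finset.card_le_card (YoungDiagram.cells_subset_iff.2 h)

@[simp]
theorem mem_stripsBelow {nu lam : YoungDiagram} : nu ∈ stripsBelow lam ↔ IsStrip nu lam := by
  simp only [stripsBelow, Finset.mem_filter, Finset.mem_biUnion, Finset.mem_range,
    mem_partitionsOf, exists_eq_right', and_iff_right_iff_imp]
  exact fun h => Nat.lt_succ_of_le (card_le_card_of_le h.1)

theorem sum_rowLen_sub {nu lam : YoungDiagram} (h : nu ≤ lam) {N : ℕ} (hN : lam.rowLen N = 0) :
    ∑ i : Fin N, (lam.rowLen i - nu.rowLen i) = lam.card - nu.card := by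
  have hle := le_iff_rowLen_le.1 h
  have hN' : nu.rowLen N = 0 := by have := hle N; lia
  rw [Fin.sum_univ_eq_sum_range (fun i => lam.rowLen i - nu.rowLen i), card_eq_sum_rowLen hN,
    card_eq_sum_rowLen hN', Finset.sum_tsub_distrib _ fun i _ => hle i]

theorem exists_rowLen_eq_of_fin {N : ℕ} {r : Fin N → ℕ} (hr : Antitone r) :
    ∃ lam : YoungDiagram, (∀ i : Fin N, lam.rowLen i = r i) ∧ lam.rowLen N = 0 := by
  obtain ⟨lam, hlam⟩ := exists_rowLen_eq (f := fun i => if h : i < N then r ⟨i, h⟩ else 0)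
    (N := N) (by
      intro a b hab
      simp only
      split_ifs with h1 h2
      · exact hr hab
      · lia
      · exact Nat.zero_le _
      · exact le_rfl) (by simp)
  exact ⟨lam, fun i => by simp [hlam], by simp [hlam]⟩

theorem rowLen_injective_of_fin {N : ℕ} {lam mu : YoungDiagram} (hlam : lam.rowLen N = 0)
    (hmu : mu.rowLen N = 0) (h : ∀ i : Fin N, lam.rowLen i = mu.rowLen i) : lam = mu := by
  refine rowLen_injective fun i => ?_
  by_cases hi : i < N
  · exact h ⟨i, hi⟩
  · have h1 := antitone_rowLen lam (not_lt.1 hi)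
    have h2 := antitone_rowLen mu (not_lt.1 hi)
    lia

end Diagrams

/-! ### Branching rules indexed by diagrams -/

section Strips

variable {R : Type*} [CommRing R]

theorem IsStrip.rowLen_eq_zero {nu lam : YoungDiagram} (h : IsStrip nu lam) {N : ℕ}
    (hN : lam.rowLen N = 0) : nu.rowLen N = 0 := by
  have := (isStrip_iff.1 h N).1
  lia

/-- The hypothesis says that the generating series of the `φ' (uInt r)` is that of the `φ (uInt r)`
divided by `1 - z t`, which is the effect of a new variable `z` on complete symmetric functions. -/
theorem map_schurU_branching {F F' : Type*} [FunLike F AlgA R] [RingHomClass F AlgA R]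
    [FunLike F' AlgA R] [RingHomClass F' AlgA R] (φ : F) (φ' : F') {z : R}
    (h : ∀ r, φ' (uInt r) = φ (uInt r) + z * φ' (uInt (r - 1))) (lam : YoungDiagram) :
    φ' (schurU lam) = ∑ nu ∈ stripsBelow lam, z ^ (lam.card - nu.card) * φ (schurU nu) := by
  have hN : lam.rowLen (lam.colLen 0) = 0 := rowLen_eq_zero_iff.2 le_rfl
  rw [map_schurU φ' hN, jacobiTrudi_branching (g := fun r => φ (uInt r))
    (fun r hr => by rw [uInt_of_neg hr, map_zero]) (by simp) h (antitone_rowLen lam) hN]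
  symm
  refine Finset.sum_nbij (fun nu i => nu.rowLen i) ?_ ?_ ?_ ?_
  · intro nu hnu
    rw [mem_stripsBelow, isStrip_iff] at hnu
    rw [Fintype.mem_piFinset]
    exact fun i => Finset.mem_Icc.2 ⟨(hnu i).2, (hnu i).1⟩
  · intro nu hnu mu hmu heq
    rw [Finset.mem_coe, mem_stripsBelow] at hnu hmu
    exact rowLen_injective_of_fin (hnu.rowLen_eq_zero hN) (hmu.rowLen_eq_zero hN)
      fun i => congrFun heq i
  · intro r hr
    rw [Finset.mem_coe, Fintype.mem_piFinset] at hr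
    simp only [Finset.mem_Icc] at hr
    obtain ⟨nu, hnu, hnu'⟩ := exists_rowLen_eq_of_fin (r := r) (by
      intro a b hab
      rcases hab.lt_or_eq with hlt | rfl
      · exact ((hr b).2.trans (antitone_rowLen lam (Nat.succ_le_of_lt hlt))).trans (hr a).1
      · exact le_rfl)
    refine ⟨nu, ?_, funext hnu⟩
    rw [Finset.mem_coe, mem_stripsBelow, isStrip_iff]
    intro i
    by_cases hi : i < lam.colLen 0
    · rw [hnu ⟨i, hi⟩]
      exact ⟨(hr ⟨i, hi⟩).2, (hr ⟨i, hi⟩).1⟩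
    · have h1 := antitone_rowLen nu (not_lt.1 hi)
      have h2 := antitone_rowLen lam ((not_lt.1 hi).trans (Nat.le_succ i))
      lia
  · intro nu hnu
    rw [mem_stripsBelow] at hnu
    rw [map_schurU φ (hnu.rowLen_eq_zero hN), Finset.prod_pow_eq_pow_sum,
      sum_rowLen_sub hnu.1 hN]
    rfl

/-- Here the generating series is multiplied by `1 + z t`, as for elementary symmetric functions.
Indexing by the strips below `lam.transpose` allows a termwise comparison with
`map_schurU_branching` for the conjugate. -/
theorem jacobiTrudi_branching_strips {g g' : ℤ → R} {z : R} (hneg : ∀ r < 0, g r = 0)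
    (h0 : g 0 = 1) (h : ∀ r, g' r = g r + z * g (r - 1)) (lam : YoungDiagram) :
    jacobiTrudi g' (lam.colLen 0) lam.rowLen =
      ∑ nu ∈ stripsBelow lam.transpose, z ^ (lam.card - nu.card) *
        jacobiTrudi g (nu.transpose.colLen 0) nu.transpose.rowLen := by
  classical
  have hN : lam.rowLen (lam.colLen 0) = 0 := rowLen_eq_zero_iff.2 le_rfl
  have hstrip : ∀ {nu}, IsStrip nu lam.transpose → nu.transpose ≤ lam := fun h => by
    rw [← YoungDiagram.transpose_le_iff, YoungDiagram.transpose_transpose]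
    exact h.1
  have hzero : ∀ {nu}, IsStrip nu lam.transpose → nu.transpose.rowLen (lam.colLen 0) = 0 := by
    intro nu hnu
    have := le_iff_rowLen_le.1 (hstrip hnu) (lam.colLen 0)
    lia
  rw [jacobiTrudi_branching_vertical h fun i hi => by
    have : lam.rowLen i ≠ 0 := fun h => by
      rw [rowLen_eq_zero_iff] at h
      lia
    lia]
  rw [← Finset.sum_filter_add_sum_filter_not _ (fun r => Antitone r),
    Finset.sum_eq_zero (s := Finset.filter (fun r => ¬ Antitone r) _), add_zero]
  swap
  · intro r hr
    rw [Finset.mem_filter, Fintype.mem_piFinset] at hr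
    rw [det_eq_zero_of_not_antitone g (antitone_rowLen lam) hr.1 hr.2, mul_zero]
  symm
  refine Finset.sum_nbij (fun nu i => nu.transpose.rowLen i) ?_ ?_ ?_ ?_
  · intro nu hnu
    rw [mem_stripsBelow, ← nu.transpose_transpose, isStrip_transpose_iff] at hnu
    rw [Finset.mem_filter, Fintype.mem_piFinset]
    exact ⟨fun i => Finset.mem_Icc.2 ⟨(hnu i).2, (hnu i).1⟩,
      fun a b hab => antitone_rowLen _ hab⟩
  · intro nu hnu mu hmu heq
    rw [Finset.mem_coe, mem_stripsBelow] at hnu hmu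
    rw [← YoungDiagram.transpose_eq_iff]
    exact rowLen_injective_of_fin (hzero hnu) (hzero hmu) fun i => congrFun heq i
  · intro r hr
    rw [Finset.mem_coe, Finset.mem_filter, Fintype.mem_piFinset] at hr
    simp only [Finset.mem_Icc] at hr
    obtain ⟨nu, hnu, hnu'⟩ := exists_rowLen_eq_of_fin hr.2
    refine ⟨nu.transpose, ?_, by simpa using funext hnu⟩
    rw [Finset.mem_coe, mem_stripsBelow, isStrip_transpose_iff]
    intro i
    by_cases hi : i < lam.colLen 0
    · rw [hnu ⟨i, hi⟩]
      exact ⟨(hr.1 ⟨i, hi⟩).2, (hr.1 ⟨i, hi⟩).1⟩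
    · have h1 := antitone_rowLen nu (not_lt.1 hi)
      have h2 := antitone_rowLen lam (not_lt.1 hi)
      lia
  · intro nu hnu
    rw [mem_stripsBelow] at hnu
    rw [← jacobiTrudi_of_le hneg h0 (rowLen_eq_zero_iff.1 (hzero hnu))
      (fun i => rowLen_eq_zero_iff.2), Finset.prod_pow_eq_pow_sum,
      sum_rowLen_sub (hstrip hnu) hN, card_transpose]
    rfl

end Strips

/-! ### The Pieri rule -/

section Pieri

theorem sum_rowLen_sub_of_isStrip {lam mu : YoungDiagram} (h : IsStrip lam mu) {N : ℕ}
    (hN : lam.rowLen N = 0) :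
    ∑ i : Fin (N + 1), (mu.rowLen i - lam.rowLen i) = mu.card - lam.card := by
  refine sum_rowLen_sub h.1 ?_
  have := (isStrip_iff.1 h N).2
  lia

theorem sum_jacobiTrudi_pieri (p : ℕ) (lam : YoungDiagram) {N : ℕ} (hN : lam.rowLen N = 0) :
    uInt p * schurU lam =
      ∑ r ∈ (Fintype.piFinset fun i : Fin (N + 1) => Finset.Icc (lam.rowLen i)
          (if (i : ℕ) = 0 then lam.rowLen 0 + p else lam.rowLen (i - 1))) with
          ∑ i : Fin (N + 1), (r i - lam.rowLen i) = p,
        (Matrix.of fun i j : Fin (N + 1) => uInt ((r i : ℤ) - (i : ℤ) + (j : ℤ))).det := by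
  -- The nilpotent parameter is the class of `X` in `A[[X]] / (X ^ (p + 1))`. Coefficients up to `X
  -- ^ p` survive in this quotient, and the coefficient of `X ^ p` isolates `uInt p` on the left and
  -- the strips of size `p` on the right.
  set I : Ideal (PowerSeries AlgA) := Ideal.span {PowerSeries.X ^ (p + 1)} with hI
  set q : PowerSeries AlgA →+* PowerSeries AlgA ⧸ I := Ideal.Quotient.mk I with hq
  have hz : q PowerSeries.X ^ (p + 1) = 0 := by
    rw [← map_pow, hq, Ideal.Quotient.eq_zero_iff_mem]
    exact Ideal.mem_span_singleton_self _
  have key := jacobiTrudi_pieri (g := fun r => q (PowerSeries.C (uInt r))) hz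
    (fun r hr => by simp [uInt_of_neg hr]) (antitone_rowLen lam) hN
  have hdet : ∀ r : Fin (N + 1) → ℕ, (Matrix.of fun i j : Fin (N + 1) =>
      q (PowerSeries.C (uInt ((r i : ℤ) - (i : ℤ) + (j : ℤ))))).det =
      q (PowerSeries.C (Matrix.of fun i j : Fin (N + 1) =>
        uInt ((r i : ℤ) - (i : ℤ) + (j : ℤ))).det) := by
    intro r
    rw [RingHom.map_det, RingHom.map_det]
    rfl
  have hjt : jacobiTrudi (fun r => q (PowerSeries.C (uInt r))) N lam.rowLen =
      q (PowerSeries.C (schurU lam)) := by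
    rw [schurU_eq_jacobiTrudi hN, map_jacobiTrudi, map_jacobiTrudi]
  simp only [hdet, hjt, ← map_pow, ← map_mul, ← map_sum, ← map_prod] at key
  rw [hq, Ideal.Quotient.eq, hI, Ideal.mem_span_singleton, PowerSeries.X_pow_dvd_iff] at key
  have h := key p (Nat.lt_succ_self p)
  rw [map_sub, sub_eq_zero, PowerSeries.coeff_mul_C, map_sum, map_sum] at h
  rw [Finset.sum_filter]
  refine Eq.trans ?_ (h.trans (Finset.sum_congr rfl fun r _ => ?_))
  · congr 1
    simp only [PowerSeries.coeff_mul_C, PowerSeries.coeff_X_pow]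
    simp
  · rw [Finset.prod_pow_eq_pow_sum, PowerSeries.coeff_mul_C, PowerSeries.coeff_X_pow]
    simp only [eq_comm (a := p), ite_mul, one_mul, zero_mul]

open Classical in
/-- The Pieri rule. -/
theorem uInt_mul_schurU (p : ℕ) (lam : YoungDiagram) :
    uInt p * schurU lam =
      ∑ mu ∈ partitionsOf (lam.card + p) with IsStrip lam mu, schurU mu := by
  obtain ⟨N, hN⟩ : ∃ N, lam.rowLen N = 0 := ⟨_, rowLen_eq_zero_iff.2 le_rfl⟩
  have hN' : ∀ {mu}, IsStrip lam mu → mu.rowLen (N + 1) = 0 := by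
    intro mu h
    have := (isStrip_iff.1 h N).2
    lia
  rw [sum_jacobiTrudi_pieri p lam hN]
  symm
  refine Finset.sum_nbij (fun mu i => mu.rowLen i) ?_ ?_ ?_ ?_
  · intro mu hmu
    rw [Finset.mem_filter, mem_partitionsOf] at hmu
    have hs := isStrip_iff.1 hmu.2
    have hsum := sum_rowLen_sub_of_isStrip hmu.2 hN
    rw [Finset.mem_filter, Fintype.mem_piFinset]
    have hp : ∑ i : Fin (N + 1), (mu.rowLen i - lam.rowLen i) = p := by
      rw [hsum]
      lia
    refine ⟨fun i => Finset.mem_Icc.2 ⟨(hs i).1, ?_⟩, hp⟩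
    split_ifs with hi
    · rw [hi]
      -- The first row is not bounded by interlacing, only by the total number `p` of added cells.
      have h1 := Finset.single_le_sum
        (f := fun i : Fin (N + 1) => mu.rowLen i - lam.rowLen i)
        (fun i _ => Nat.zero_le _) (Finset.mem_univ 0)
      rw [hp] at h1
      simp only [Fin.val_zero] at h1
      lia
    · have := (hs (i - 1)).2
      rwa [show (i : ℕ) - 1 + 1 = i by lia] at this
  · intro mu hmu nu hnu heq
    rw [Finset.mem_coe, Finset.mem_filter] at hmu hnu
    exact rowLen_injective_of_fin (hN' hmu.2) (hN' hnu.2) fun i => congrFun heq i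
  · intro r hr
    rw [Finset.mem_coe, Finset.mem_filter, Fintype.mem_piFinset] at hr
    simp only [Finset.mem_Icc] at hr
    obtain ⟨hr, hp⟩ := hr
    obtain ⟨mu, hmu, hmu'⟩ := exists_rowLen_eq_of_fin (r := r) (by
      intro a b hab
      rcases hab.lt_or_eq with hlt | rfl
      · have h1 := (hr b).2
        have hlt' : (a : ℕ) < b := hlt
        rw [if_neg (by lia)] at h1
        exact (h1.trans (antitone_rowLen lam (by lia))).trans (hr a).1
      · exact le_rfl)
    have hs : IsStrip lam mu := by
      rw [isStrip_iff]
      intro i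
      refine ⟨?_, ?_⟩
      · by_cases hi : i < N + 1
        · rw [hmu ⟨i, hi⟩]
          exact (hr ⟨i, hi⟩).1
        · have := antitone_rowLen lam (show N ≤ i by lia)
          lia
      · by_cases hi : i + 1 < N + 1
        · rw [hmu ⟨i + 1, hi⟩]
          simpa using (hr ⟨i + 1, hi⟩).2
        · have := antitone_rowLen mu (show N + 1 ≤ i + 1 by lia)
          lia
    refine ⟨mu, ?_, funext hmu⟩
    rw [Finset.mem_coe, Finset.mem_filter, mem_partitionsOf]
    refine ⟨?_, hs⟩
    have h1 := sum_rowLen_sub_of_isStrip hs hN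
    simp only [hmu, hp] at h1
    have := card_le_card_of_le hs.1
    lia
  · intro mu hmu
    rw [Finset.mem_filter] at hmu
    rw [schurU_eq_jacobiTrudi (hN' hmu.2)]
    rfl

end Pieri

/-! ### Counting chains of horizontal strips -/

section KostkaRecursion

/-- The number of chains of horizontal strips of sizes `α 0, …, α (n - 1)` from `⊥` to `lam`. -/
noncomputable def stripChains (α : ℕ → ℕ) : ℕ → YoungDiagram → ℕ
  | 0, lam => if lam.card = 0 then 1 else 0
  | n + 1, lam => ∑ nu ∈ stripsBelow lam with lam.card = nu.card + α n, stripChains α n nu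

theorem stripChains_eq_zero {α : ℕ → ℕ} {n : ℕ} {lam : YoungDiagram}
    (h : lam.card ≠ ∑ i ∈ Finset.range n, α i) : stripChains α n lam = 0 := by
  induction n generalizing lam with
  | zero => simpa [stripChains] using h
  | succ n ih =>
    rw [stripChains]
    refine Finset.sum_eq_zero fun nu hnu => ih fun h' => h ?_
    rw [Finset.mem_filter] at hnu
    rw [Finset.sum_range_succ, hnu.2, h']

theorem eq_bot_of_card_eq_zero {lam : YoungDiagram} (h : lam.card = 0) : lam = ⊥ := by
  ext c
  rw [YoungDiagram.card, Finset.card_eq_zero] at h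
  simp [h]

theorem schurU_of_card_eq_zero {lam : YoungDiagram} (h : lam.card = 0) : schurU lam = 1 := by
  have h0 : lam.rowLen 0 = 0 := by
    rw [YoungDiagram.rowLen_eq_card, Finset.card_eq_zero]
    rw [YoungDiagram.card, Finset.card_eq_zero] at h
    rw [YoungDiagram.row, h, Finset.filter_empty]
  rw [schurU_eq_jacobiTrudi h0]
  simp [jacobiTrudi]

/-- The Pieri rule iterated. The sequence `α` need not be decreasing; later it is an arbitrary
exponent vector. -/
theorem prod_uInt_eq_sum (α : ℕ → ℕ) (n : ℕ) :
    ∏ i ∈ Finset.range n, uInt (α i) =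
      ∑ lam ∈ partitionsOf (∑ i ∈ Finset.range n, α i),
        (stripChains α n lam : ℤ) • schurU lam := by
  classical
  induction n with
  | zero =>
    rw [Finset.sum_eq_single (⊥ : YoungDiagram)]
    · rw [schurU_of_card_eq_zero rfl]
      simp [stripChains]
    · intro lam hlam hne
      rw [mem_partitionsOf] at hlam
      exact (hne (eq_bot_of_card_eq_zero hlam)).elim
    · intro h
      exact (h (mem_partitionsOf.2 rfl)).elim
  | succ n ih =>
    rw [Finset.prod_range_succ, ih, Finset.sum_mul, Finset.sum_range_succ]
    set m := ∑ i ∈ Finset.range n, α i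
    have h1 : ∀ nu ∈ partitionsOf m, ((stripChains α n nu : ℤ) • schurU nu) * uInt (α n) =
        ∑ lam ∈ partitionsOf (m + α n), if IsStrip nu lam then
          (stripChains α n nu : ℤ) • schurU lam else 0 := by
      intro nu hnu
      rw [mem_partitionsOf] at hnu
      rw [smul_mul_assoc, mul_comm, uInt_mul_schurU, hnu, Finset.smul_sum, Finset.sum_filter]
    rw [Finset.sum_congr rfl h1, Finset.sum_comm]
    refine Finset.sum_congr rfl fun lam hlam => ?_
    rw [mem_partitionsOf] at hlam
    rw [← Finset.sum_filter, ← Finset.sum_smul, stripChains, Nat.cast_sum]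
    congr 1
    refine Finset.sum_congr ?_ fun _ _ => rfl
    ext nu
    simp only [Finset.mem_filter, mem_partitionsOf, mem_stripsBelow]
    constructor
    · rintro ⟨h, h'⟩
      exact ⟨h', by lia⟩
    · rintro ⟨h, h'⟩
      exact ⟨by lia, h⟩

end KostkaRecursion

/-! ### Semistandard tableaux as chains of horizontal strips -/

section Tableaux

/-- The semistandard tableaux of shape `lam` with entries less than `n` and content `α`. -/
def BoundedTableaux (α : ℕ → ℕ) (n : ℕ) (lam : YoungDiagram) : Type :=
  {T : SemistandardYoungTableau lam // (∀ c ∈ lam, T c.1 c.2 < n) ∧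
    ∀ i < n, (lam.cells.filter fun c => T c.1 c.2 = i).card = α i}

open Classical in
/-- The tableau obtained by filling a horizontal strip with the entry `n`. -/
noncomputable def extendTableau {nu lam : YoungDiagram} (h : IsStrip nu lam) {n : ℕ}
    (T : SemistandardYoungTableau nu) (hT : ∀ c ∈ nu, T c.1 c.2 < n) :
    SemistandardYoungTableau lam where
  entry i j := if (i, j) ∈ nu then T i j else if (i, j) ∈ lam then n else 0
  row_weak' := by
    intro i j1 j2 hj hmem
    by_cases h2 : (i, j2) ∈ nu
    · rw [if_pos h2, if_pos (nu.up_left_mem le_rfl hj.le h2)]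
      exact T.row_weak hj h2
    · rw [if_neg h2, if_pos hmem]
      split_ifs with h3
      · exact (hT _ h3).le
      · exact le_rfl
      · exact Nat.zero_le _
  col_strict' := by
    intro i1 i2 j hi hmem
    have h1 : (i1, j) ∈ nu := h.2 i1 j (lam.up_left_mem hi le_rfl hmem)
    rw [if_pos h1]
    by_cases h2 : (i2, j) ∈ nu
    · rw [if_pos h2]
      exact T.col_strict hi h2
    · rw [if_neg h2, if_pos hmem]
      exact hT _ h1
  zeros' := by
    intro i j hmem
    rw [if_neg fun h' => hmem (h.1 h'), if_neg hmem]

theorem extendTableau_of_mem {nu lam : YoungDiagram} (h : IsStrip nu lam) {n : ℕ}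
    (T : SemistandardYoungTableau nu) (hT : ∀ c ∈ nu, T c.1 c.2 < n) {i j : ℕ}
    (hm : (i, j) ∈ nu) : extendTableau h T hT i j = T i j :=
  if_pos hm

theorem extendTableau_of_notMem {nu lam : YoungDiagram} (h : IsStrip nu lam) {n : ℕ}
    (T : SemistandardYoungTableau nu) (hT : ∀ c ∈ nu, T c.1 c.2 < n) {i j : ℕ}
    (hm : (i, j) ∉ nu) (hm' : (i, j) ∈ lam) : extendTableau h T hT i j = n :=
  (if_neg hm).trans (if_pos hm')

theorem extendTableau_lt_iff {nu lam : YoungDiagram} (h : IsStrip nu lam) {n : ℕ}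
    (T : SemistandardYoungTableau nu) (hT : ∀ c ∈ nu, T c.1 c.2 < n) {c : ℕ × ℕ} (hc : c ∈ lam) :
    extendTableau h T hT c.1 c.2 < n ↔ c ∈ nu := by
  by_cases hm : c ∈ nu
  · rw [extendTableau_of_mem h T hT hm]
    exact iff_of_true (hT c hm) hm
  · rw [extendTableau_of_notMem h T hT hm hc]
    exact iff_of_false (lt_irrefl n) hm

theorem card_filter_extendTableau {nu lam : YoungDiagram} (h : IsStrip nu lam) {n : ℕ}
    (T : SemistandardYoungTableau nu) (hT : ∀ c ∈ nu, T c.1 c.2 < n) {i : ℕ} (hi : i < n) :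
    (lam.cells.filter fun c => extendTableau h T hT c.1 c.2 = i).card =
      (nu.cells.filter fun c => T c.1 c.2 = i).card := by
  congr 1
  ext c
  simp only [Finset.mem_filter, YoungDiagram.mem_cells]
  constructor
  · rintro ⟨hc, heq⟩
    have hm : c ∈ nu := (extendTableau_lt_iff h T hT hc).1 (heq ▸ hi)
    exact ⟨hm, by rw [← heq, extendTableau_of_mem h T hT hm]⟩
  · rintro ⟨hc, heq⟩
    exact ⟨h.1 hc, by rw [extendTableau_of_mem h T hT hc, heq]⟩

theorem card_filter_extendTableau_last {nu lam : YoungDiagram} (h : IsStrip nu lam) {n : ℕ}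
    (T : SemistandardYoungTableau nu) (hT : ∀ c ∈ nu, T c.1 c.2 < n) :
    (lam.cells.filter fun c => extendTableau h T hT c.1 c.2 = n).card = lam.card - nu.card := by
  rw [YoungDiagram.card, YoungDiagram.card,
    ← Finset.card_sdiff_of_subset (YoungDiagram.cells_subset_iff.2 h.1)]
  congr 1
  ext c
  simp only [Finset.mem_filter, YoungDiagram.mem_cells, Finset.mem_sdiff]
  refine and_congr_right fun hc => ?_
  constructor
  · intro heq hm
    exact lt_irrefl _ (heq ▸ (extendTableau_lt_iff h T hT hc).2 hm)
  · intro hm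
    exact extendTableau_of_notMem h T hT hm hc

/-- The shape of the entries less than `n` of a tableau. -/
def shapeBelow {lam : YoungDiagram} (T : SemistandardYoungTableau lam) (n : ℕ) :
    YoungDiagram where
  cells := lam.cells.filter fun c => T c.1 c.2 < n
  isLowerSet := by
    rintro ⟨i2, j2⟩ ⟨i1, j1⟩ ⟨hi, hj⟩ hm
    simp only [Finset.coe_filter, Set.mem_ofPred_eq, YoungDiagram.mem_cells] at hm ⊢
    exact ⟨lam.up_left_mem hi hj hm.1, ((T.row_weak_of_le hj (lam.up_left_mem hi le_rfl hm.1)).trans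
      (T.col_weak hi hm.1)).trans_lt hm.2⟩

theorem mem_shapeBelow {lam : YoungDiagram} {T : SemistandardYoungTableau lam} {n : ℕ}
    {c : ℕ × ℕ} : c ∈ shapeBelow T n ↔ c ∈ lam ∧ T c.1 c.2 < n := by
  rw [← YoungDiagram.mem_cells, shapeBelow, Finset.mem_filter, YoungDiagram.mem_cells]

/-- Columns increase strictly, so the cell above any cell holds an entry below `n`. -/
theorem isStrip_shapeBelow {lam : YoungDiagram} {T : SemistandardYoungTableau lam} {n : ℕ}
    (hT : ∀ c ∈ lam, T c.1 c.2 < n + 1) : IsStrip (shapeBelow T n) lam := by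
  refine ⟨fun c hc => (mem_shapeBelow.1 hc).1, fun i j h => mem_shapeBelow.2
    ⟨lam.up_left_mem (Nat.le_succ i) le_rfl h, ?_⟩⟩
  exact (T.col_strict (Nat.lt_succ_self i) h).trans_le (Nat.le_of_lt_succ (hT _ h))

open Classical in
/-- The restriction of a tableau to its entries less than `n`. -/
noncomputable def restrictTableau {lam : YoungDiagram} (T : SemistandardYoungTableau lam) (n : ℕ) :
    SemistandardYoungTableau (shapeBelow T n) where
  entry i j := if (i, j) ∈ shapeBelow T n then T i j else 0
  row_weak' := by
    intro i j1 j2 hj hm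
    rw [if_pos hm, if_pos ((shapeBelow T n).up_left_mem le_rfl hj.le hm)]
    exact T.row_weak hj (mem_shapeBelow.1 hm).1
  col_strict' := by
    intro i1 i2 j hi hm
    rw [if_pos hm, if_pos ((shapeBelow T n).up_left_mem hi.le le_rfl hm)]
    exact T.col_strict hi (mem_shapeBelow.1 hm).1
  zeros' := fun h => if_neg h

theorem restrictTableau_of_mem {lam : YoungDiagram} {T : SemistandardYoungTableau lam} {n : ℕ}
    {i j : ℕ} (h : (i, j) ∈ shapeBelow T n) : restrictTableau T n i j = T i j :=
  if_pos h

theorem restrictTableau_lt {lam : YoungDiagram} (T : SemistandardYoungTableau lam) (n : ℕ) :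
    ∀ c ∈ shapeBelow T n, restrictTableau T n c.1 c.2 < n := by
  intro c hc
  rw [restrictTableau_of_mem hc]
  exact (mem_shapeBelow.1 hc).2

theorem extendTableau_restrictTableau {lam : YoungDiagram} {T : SemistandardYoungTableau lam}
    {n : ℕ} (hT : ∀ c ∈ lam, T c.1 c.2 < n + 1) :
    extendTableau (isStrip_shapeBelow hT) (restrictTableau T n) (restrictTableau_lt T n) = T := by
  ext i j
  by_cases h : (i, j) ∈ shapeBelow T n
  · rw [extendTableau_of_mem _ _ _ h, restrictTableau_of_mem h]
  · by_cases h' : (i, j) ∈ lam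
    · rw [extendTableau_of_notMem _ _ _ h h']
      have h1 : ¬ T i j < n := fun hlt => h (mem_shapeBelow.2 ⟨h', hlt⟩)
      have h2 : T i j < n + 1 := hT _ h'
      lia
    · rw [SemistandardYoungTableau.zeros _ h', SemistandardYoungTableau.zeros _ h']

open Classical in
/-- Adding a horizontal strip of entries `n`. -/
noncomputable def addStrip (α : ℕ → ℕ) (n : ℕ) (lam : YoungDiagram)
    (x : Σ nu : {nu // nu ∈ (stripsBelow lam).filter fun nu => lam.card = nu.card + α n},
      BoundedTableaux α n nu) : BoundedTableaux α (n + 1) lam :=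
  have hs : IsStrip x.1.1 lam := mem_stripsBelow.1 (Finset.mem_filter.1 x.1.2).1
  ⟨extendTableau hs x.2.1 x.2.2.1, by
    constructor
    · intro c hc
      by_cases hm : c ∈ x.1.1
      · rw [extendTableau_of_mem _ _ _ hm]
        exact (x.2.2.1 c hm).trans (Nat.lt_succ_self n)
      · rw [extendTableau_of_notMem _ _ _ hm hc]
        exact Nat.lt_succ_self n
    · intro i hi
      rcases Nat.lt_succ_iff_lt_or_eq.1 hi with hlt | rfl
      · rw [card_filter_extendTableau _ _ _ hlt]
        exact x.2.2.2 i hlt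
      · rw [card_filter_extendTableau_last]
        exact Nat.sub_eq_of_eq_add' (Finset.mem_filter.1 x.1.2).2⟩

/-- The inverse cuts off the cells with entry `n`: the smaller shape is recovered as the set of
cells with entries below `n`, and the filling as the restriction to it. -/
theorem addStrip_bijective (α : ℕ → ℕ) (n : ℕ) (lam : YoungDiagram) :
    Function.Bijective (addStrip α n lam) := by
  constructor
  · rintro ⟨⟨nu, hnu⟩, T, hT⟩ ⟨⟨nu', hnu'⟩, T', hT'⟩ heq
    have hs : IsStrip nu lam := mem_stripsBelow.1 (Finset.mem_filter.1 hnu).1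
    have hs' : IsStrip nu' lam := mem_stripsBelow.1 (Finset.mem_filter.1 hnu').1
    have heq' : extendTableau hs T hT.1 = extendTableau hs' T' hT'.1 := congrArg Subtype.val heq
    obtain rfl : nu = nu' := by
      ext c
      rw [YoungDiagram.mem_cells, YoungDiagram.mem_cells]
      by_cases hc : c ∈ lam
      · rw [← extendTableau_lt_iff hs T hT.1 hc, ← extendTableau_lt_iff hs' T' hT'.1 hc, heq']
      · exact iff_of_false (fun h => hc (hs.1 h)) (fun h => hc (hs'.1 h))
    obtain rfl : T = T' := by
      ext i j
      by_cases hm : (i, j) ∈ nu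
      · rw [← extendTableau_of_mem hs T hT.1 hm, heq', extendTableau_of_mem hs' T' hT'.1 hm]
      · rw [T.zeros hm, T'.zeros hm]
    rfl
  · rintro ⟨T, hT, hc⟩
    have hs := isStrip_shapeBelow hT
    have heq := extendTableau_restrictTableau hT
    have hlast := card_filter_extendTableau_last hs _ (restrictTableau_lt T n)
    rw [heq, hc n (Nat.lt_succ_self n)] at hlast
    refine ⟨⟨⟨shapeBelow T n, Finset.mem_filter.2 ⟨mem_stripsBelow.2 hs, ?_⟩⟩,
      restrictTableau T n, restrictTableau_lt T n, fun i hi => ?_⟩, Subtype.ext heq⟩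
    · have := card_le_card_of_le hs.1
      lia
    · rw [← card_filter_extendTableau hs _ (restrictTableau_lt T n) hi, heq]
      exact hc i (hi.trans (Nat.lt_succ_self n))

/-- Finiteness is carried through the induction because `Nat.card_sigma` needs finite fibres. -/
theorem finite_and_card_boundedTableaux (α : ℕ → ℕ) (n : ℕ) (lam : YoungDiagram) :
    Finite (BoundedTableaux α n lam) ∧ Nat.card (BoundedTableaux α n lam) = stripChains α n lam := by
  induction n generalizing lam with
  | zero =>
    by_cases h : lam.card = 0
    · obtain rfl := eq_bot_of_card_eq_zero h
      have : Subsingleton (BoundedTableaux α 0 ⊥) := by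
        refine ⟨fun T T' => Subtype.ext ?_⟩
        ext i j
        rw [T.1.zeros (YoungDiagram.notMem_bot _), T'.1.zeros (YoungDiagram.notMem_bot _)]
      have : Nonempty (BoundedTableaux α 0 ⊥) :=
        ⟨⟨default, fun c hc => (YoungDiagram.notMem_bot c hc).elim, fun i hi => by lia⟩⟩
      exact ⟨inferInstance, by rw [stripChains, if_pos h, Nat.card_unique]⟩
    · have : IsEmpty (BoundedTableaux α 0 lam) := by
        refine ⟨fun T => ?_⟩
        obtain ⟨c, hc⟩ := Finset.card_pos.1 (Nat.pos_of_ne_zero h)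
        exact Nat.not_lt_zero _ (T.2.1 c hc)
      exact ⟨inferInstance, by rw [stripChains, if_neg h, Nat.card_of_isEmpty]⟩
  | succ n ih =>
    have hfin : ∀ nu, Finite (BoundedTableaux α n nu) := fun nu => (ih nu).1
    refine ⟨Finite.of_surjective _ (addStrip_bijective α n lam).2, ?_⟩
    rw [← Nat.card_eq_of_bijective _ (addStrip_bijective α n lam), Nat.card_sigma, stripChains]
    simp only [ih]
    exact Finset.sum_coe_sort _ fun nu => stripChains α n nu

/-- The content condition for all `i` already bounds the entries by `N`, since an entry `i ≥ N`
would have multiplicity `mu.rowLen i = 0`. -/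
theorem kostka_eq_stripChains (lam mu : YoungDiagram) {N : ℕ} (hN : mu.rowLen N = 0) :
    kostka lam mu = stripChains mu.rowLen N lam := by
  rw [← (finite_and_card_boundedTableaux mu.rowLen N lam).2, kostka, BoundedTableaux]
  refine Nat.card_congr (Equiv.subtypeEquivRight fun T => ?_)
  constructor
  · intro h
    refine ⟨fun c hc => ?_, fun i _ => h i⟩
    by_contra! hle
    have h1 : 0 < (lam.cells.filter fun c' => T c'.1 c'.2 = T c.1 c.2).card :=
      Finset.card_pos.2 ⟨c, Finset.mem_filter.2 ⟨hc, rfl⟩⟩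
    rw [h] at h1
    have := antitone_rowLen mu hle
    lia
  · rintro ⟨h1, h2⟩ i
    by_cases hi : i < N
    · exact h2 i hi
    · have h3 := antitone_rowLen mu (not_lt.1 hi)
      rw [show mu.rowLen i = 0 by lia, Finset.card_eq_zero, Finset.filter_eq_empty_iff]
      intro c hc heq
      exact hi (heq ▸ h1 c hc)

theorem uPart_eq_prod {mu : YoungDiagram} {N : ℕ} (hN : mu.rowLen N = 0) :
    uPart mu = ∏ i ∈ Finset.range N, uInt (mu.rowLen i) := by
  have h : mu.colLen 0 ≤ N := rowLen_eq_zero_iff.1 hN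
  have h1 : uPart mu = ∏ i ∈ Finset.range (mu.colLen 0), uInt (mu.rowLen i) :=
    Fin.prod_univ_eq_prod_range (fun i => uInt (mu.rowLen i)) _
  rw [h1]
  refine Finset.prod_subset (Finset.range_mono h) fun i _ hi => ?_
  rw [Finset.mem_range, not_lt, ← rowLen_eq_zero_iff] at hi
  rw [hi, Nat.cast_zero, uInt_zero]

theorem uPart_eq_sum_kostka (mu : YoungDiagram) :
    uPart mu = ∑ lam ∈ partitionsOf mu.card, (kostka lam mu : ℤ) • schurU lam := by
  have hN : mu.rowLen (mu.colLen 0) = 0 := rowLen_eq_zero_iff.2 le_rfl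
  rw [uPart_eq_prod hN, prod_uInt_eq_sum, ← card_eq_sum_rowLen hN]
  simp only [kostka_eq_stripChains _ mu hN]

end Tableaux

/-! ### Sorting exponent vectors into partitions -/

section Sorting

theorem exists_perm_rowLen_eq {d : ℕ → ℕ} {N : ℕ} (hd : ∀ i, N ≤ i → d i = 0) :
    ∃ lam : YoungDiagram, lam.rowLen N = 0 ∧
      ∃ s : Equiv.Perm ℕ, ∀ i, d (s i) = lam.rowLen i := by
  set σ := Tuple.sort fun i : Fin N => OrderDual.toDual (d i) with hσ
  have hanti : Antitone fun i : Fin N => d (σ i) :=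
    fun a b hab => Tuple.monotone_sort (fun i : Fin N => OrderDual.toDual (d i)) hab
  obtain ⟨lam, hlam, hN⟩ := exists_rowLen_eq_of_fin hanti
  refine ⟨lam, hN, σ.extendDomain Fin.equivSubtype, fun i => ?_⟩
  by_cases hi : i < N
  · have h := σ.extendDomain_apply_image Fin.equivSubtype ⟨i, hi⟩
    have h' : σ.extendDomain Fin.equivSubtype i = σ ⟨i, hi⟩ := h
    rw [h', ← hlam ⟨i, hi⟩]
  · have h' : σ.extendDomain Fin.equivSubtype i = i :=
      Equiv.Perm.extendDomain_apply_not_subtype _ _ hi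
    rw [h', hd i (not_lt.1 hi)]
    have := antitone_rowLen lam (not_lt.1 hi)
    lia

/-- The permutation need not preserve `Finset.range N`, so both sides are compared with a finite
product over all of ℕ. -/
theorem prod_range_comp_perm {M : Type*} [CommMonoid M] (F : ℕ → M) (hF : F 0 = 1)
    {d e : ℕ → ℕ} {N : ℕ} (hd : ∀ i, N ≤ i → d i = 0) (he : ∀ i, N ≤ i → e i = 0)
    {s : Equiv.Perm ℕ} (hs : ∀ i, d (s i) = e i) :
    ∏ i ∈ Finset.range N, F (e i) = ∏ i ∈ Finset.range N, F (d i) := by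
  have h : ∀ f : ℕ → ℕ, (∀ i, N ≤ i → f i = 0) →
      ∏ᶠ i, F (f i) = ∏ i ∈ Finset.range N, F (f i) := by
    intro f hf
    refine finprod_eq_prod_of_mulSupport_subset _ fun i hi => ?_
    rw [Finset.coe_range, Set.mem_Iio]
    by_contra! hle
    exact hi (by simp [hf i hle, hF])
  rw [← h e he, ← h d hd, ← finprod_comp_equiv s (f := fun i => F (d i))]
  simp only [hs]

theorem rowLen_eq_zero_of_le {lam : YoungDiagram} {N : ℕ} (hN : lam.rowLen N = 0) :
    ∀ i, N ≤ i → lam.rowLen i = 0 := by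
  intro i hi
  have := antitone_rowLen lam hi
  lia

/-- The conjugate part `λ'_j` counts the indices `i` with `λ_i > j`, a number that does not change
under permutation. -/
theorem eq_of_perm_rowLen {lam mu : YoungDiagram} (s : Equiv.Perm ℕ)
    (h : ∀ i, lam.rowLen (s i) = mu.rowLen i) : lam = mu := by
  have hcol : ∀ (nu : YoungDiagram) j, Nat.card {i // j < nu.rowLen i} = nu.colLen j := by
    intro nu j
    have h1 : ∀ i, j < nu.rowLen i ↔ i < nu.colLen j := fun i => by
      rw [← YoungDiagram.mem_iff_lt_rowLen, YoungDiagram.mem_iff_lt_colLen]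
    rw [Nat.card_congr ((Equiv.subtypeEquivRight h1).trans Fin.equivSubtype.symm), Nat.card_fin]
  rw [← YoungDiagram.transpose_eq_iff]
  refine rowLen_injective fun j => ?_
  rw [YoungDiagram.rowLen_transpose, YoungDiagram.rowLen_transpose, ← hcol, ← hcol]
  exact Nat.card_congr (s.symm.subtypeEquiv fun i => by rw [← h, Equiv.apply_symm_apply])

end Sorting

/-! ### Invertibility of the Kostka matrix and the identities in A ⊗ A -/

section KostkaMatrix

theorem uVec_mem_span {l : ℕ} (b : Fin l → ℤ) {n : ℕ} (hb : ∑ i, b i = n) :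
    uVec b ∈ Submodule.span ℤ (Set.range fun nu : partitionsOf n => uPart nu) := by
  by_cases hneg : ∃ i, b i < 0
  · obtain ⟨i, hi⟩ := hneg
    rw [uVec, Finset.prod_eq_zero (Finset.mem_univ i) (uInt_of_neg hi)]
    exact Submodule.zero_mem _
  · push Not at hneg
    set d : ℕ → ℕ := fun i => if h : i < l then (b ⟨i, h⟩).toNat else 0 with hd
    have hdl : ∀ i, l ≤ i → d i = 0 := fun i hi => dif_neg (by lia)
    have hdb : ∀ i : Fin l, (d i : ℤ) = b i := fun i => by simp [hd, hneg i]
    obtain ⟨nu, hN, s, hs⟩ := exists_perm_rowLen_eq hdl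
    have hu : uVec b = uPart nu := by
      rw [uPart_eq_prod hN, prod_range_comp_perm (fun r : ℕ => uInt r) (by simp) hdl
        (rowLen_eq_zero_of_le hN) hs, ← Fin.prod_univ_eq_prod_range (fun i => uInt (d i))]
      simp only [hdb, uVec]
    have hcard : nu.card = n := by
      have h1 : ∑ i ∈ Finset.range l, nu.rowLen i = ∑ i ∈ Finset.range l, d i :=
        -- The sum of the parts is treated as a product in `Multiplicative ℕ`.
        Multiplicative.ofAdd.injective (by
          simpa only [ofAdd_sum] using prod_range_comp_perm Multiplicative.ofAdd rfl hdl
            (rowLen_eq_zero_of_le hN) hs)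
      rw [card_eq_sum_rowLen hN, h1, ← Fin.sum_univ_eq_sum_range, ← Nat.cast_inj (R := ℤ), ← hb]
      push_cast
      simp only [hdb]
    rw [hu]
    exact Submodule.subset_span ⟨⟨nu, mem_partitionsOf.2 hcard⟩, rfl⟩

/-- The exponents `λ_i - i + σ i` sum to `|λ|` for every permutation `σ`, so each term of the
determinant is zero or some `u_ν` with `|ν| = |λ|`. -/
theorem schurU_mem_span (lam : YoungDiagram) :
    schurU lam ∈ Submodule.span ℤ (Set.range fun nu : partitionsOf lam.card => uPart nu) := by
  rw [schurU, schurVec_eq_sum]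
  refine Submodule.sum_mem _ fun σ _ => Submodule.smul_mem _ _ (uVec_mem_span _ ?_)
  have h1 : ∑ i : Fin (lam.colLen 0), ((σ i : Fin _) : ℤ) =
      ∑ i : Fin (lam.colLen 0), ((i : Fin _) : ℤ) :=
    Equiv.sum_comp σ fun i : Fin (lam.colLen 0) => ((i : Fin _) : ℤ)
  have hN : lam.rowLen (lam.colLen 0) = 0 := rowLen_eq_zero_iff.2 le_rfl
  rw [Finset.sum_add_distrib, Finset.sum_sub_distrib, h1, sub_add_cancel,
    card_eq_sum_rowLen hN, ← Fin.sum_univ_eq_sum_range]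
  push_cast
  rfl

theorem uPart_eq_monomial (lam : YoungDiagram) :
    uPart lam = MvPolynomial.monomial
      (Multiset.toFinsupp ((lam.rowLens : Multiset ℕ).map Nat.pred)) 1 := by
  have h1 : (lam.rowLens : Multiset ℕ).map Nat.pred =
      ∑ i ∈ Finset.range (lam.colLen 0), {lam.rowLen i - 1} := by
    have : (lam.rowLens : Multiset ℕ) = (Finset.range (lam.colLen 0)).val.map lam.rowLen := rfl
    rw [this, Finset.sum, Multiset.map_map, ← Multiset.sum_map_singleton
      (Multiset.map (Nat.pred ∘ lam.rowLen) _), Multiset.map_map]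
    rfl
  rw [h1, map_sum, MvPolynomial.monomial_sum_one,
    uPart_eq_prod (rowLen_eq_zero_iff.2 (le_refl (lam.colLen 0)))]
  refine Finset.prod_congr rfl fun i hi => ?_
  rw [Multiset.toFinsupp_singleton]
  have h2 : lam.rowLen i ≠ 0 := by
    rw [Ne, rowLen_eq_zero_iff, not_le]
    exact Finset.mem_range.1 hi
  obtain ⟨k, hk⟩ := Nat.exists_eq_succ_of_ne_zero h2
  rw [hk, Nat.cast_succ, uInt_succ]
  rfl

/-- The `u_λ` are distinct monomials. Lowering each part by one, forced by `X n` being `u_{n+1}`,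
loses nothing because the parts are positive. -/
theorem linearIndependent_uPart : LinearIndependent ℤ uPart := by
  have hinj : Function.Injective fun lam : YoungDiagram =>
      Multiset.toFinsupp ((lam.rowLens : Multiset ℕ).map Nat.pred) := by
    intro lam mu h
    have h1 := Multiset.toFinsupp.injective h
    have h2 : ∀ nu : YoungDiagram, ((nu.rowLens : Multiset ℕ).map Nat.pred).map Nat.succ =
        (nu.rowLens : Multiset ℕ) := by
      intro nu
      rw [Multiset.map_map]
      refine (Multiset.map_congr rfl fun x hx => ?_).trans (Multiset.map_id _)
      exact Nat.succ_pred_eq_of_pos (nu.pos_of_mem_rowLens x (Multiset.mem_coe.1 hx))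
    have h3 : (lam.rowLens : Multiset ℕ) = mu.rowLens := by rw [← h2 lam, h1, h2 mu]
    have h4 : lam.rowLens = mu.rowLens :=
      (Multiset.coe_eq_coe.1 h3).eq_of_pairwise
        (fun a b _ _ hab hba => le_antisymm hba hab) lam.rowLens_sorted.pairwise
        mu.rowLens_sorted.pairwise
    exact YoungDiagram.equivListRowLens.injective (Subtype.ext h4)
  have h := (MvPolynomial.basisMonomials ℕ ℤ).linearIndependent.comp _ hinj
  convert h using 1
  · ext1 lam
    simp [uPart_eq_monomial]
  · rfl
  · exact Subsingleton.elim _ _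

open Classical in
-- With `u = Kᵀ U` and `U = C u` for an integer matrix `C`, independence of the `u_ν` gives `Kᵀ C =
-- 1`. Triangularity of `K` plays no role.
theorem isUnit_det_kostkaMatrix (n : ℕ) : IsUnit (kostkaMatrix n).det := by
  have h : ∀ lam : partitionsOf n, ∃ c : partitionsOf n → ℤ, ∑ nu, c nu • uPart nu = schurU lam := by
    rintro ⟨lam, hlam⟩
    obtain rfl := mem_partitionsOf.1 hlam
    exact (Submodule.mem_span_range_iff_exists_fun ℤ).1 (schurU_mem_span lam)
  choose c hc using h
  have hmul : (kostkaMatrix n).transpose * Matrix.of c = 1 := by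
    ext mu nu
    have hli : LinearIndependent ℤ fun nu : partitionsOf n => uPart nu :=
      linearIndependent_uPart.comp _ Subtype.val_injective
    have h1 : ∑ nu : partitionsOf n, ((kostkaMatrix n).transpose * Matrix.of c) mu nu • uPart nu =
        ∑ nu : partitionsOf n, (1 : Matrix (partitionsOf n) (partitionsOf n) ℤ) mu nu •
          uPart nu := by
      have h2 : ∑ nu : partitionsOf n, (1 : Matrix (partitionsOf n) (partitionsOf n) ℤ) mu nu •
          uPart nu = uPart mu := by
        rw [Finset.sum_eq_single mu]
        · simp
        · intro nu _ hne
          rw [Matrix.one_apply_ne hne.symm, zero_smul]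
        · simp
      rw [h2, uPart_eq_sum_kostka, mem_partitionsOf.1 mu.2,
        ← Finset.sum_coe_sort (partitionsOf n)
          (fun lam => (kostka lam mu : ℤ) • schurU lam)]
      simp only [Matrix.mul_apply, Finset.sum_smul, ← hc, Finset.smul_sum, smul_smul]
      rw [Finset.sum_comm]
      rfl
    exact congrFun (Fintype.linearIndependent_iffₛ.1 hli _ _ h1 |> funext) nu
  have hdet := congrArg Matrix.det hmul
  rw [Matrix.det_mul, Matrix.det_transpose, Matrix.det_one] at hdet
  exact IsUnit.of_mul_eq_one _ hdet

open Classical in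
theorem tPart_eq {lam : YoungDiagram} {n : ℕ} (h : lam.card = n) :
    tPart lam = ∑ mu : partitionsOf n,
      (kostkaMatrix n)⁻¹ ⟨lam, mem_partitionsOf.2 h⟩ mu • schurU mu := by
  subst h
  rfl

theorem schurU_eq_sum_tPart (lam : YoungDiagram) :
    schurU lam = ∑ mu ∈ partitionsOf lam.card, (kostka lam mu : ℤ) • tPart mu := by
  classical
  set n := lam.card with hn
  set lam' : partitionsOf n := ⟨lam, mem_partitionsOf.2 rfl⟩
  rw [← Finset.sum_coe_sort (partitionsOf n) (fun mu => (kostka lam mu : ℤ) • tPart mu)]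
  have h1 : ∀ mu : partitionsOf n, (kostka lam mu : ℤ) • tPart mu =
      ∑ nu : partitionsOf n, (kostkaMatrix n lam' mu * (kostkaMatrix n)⁻¹ mu nu) • schurU nu := by
    intro mu
    rw [tPart_eq (mem_partitionsOf.1 mu.2), Finset.smul_sum]
    simp only [smul_smul]
    rfl
  simp only [h1]
  rw [Finset.sum_comm]
  simp only [← Finset.sum_smul, ← Matrix.mul_apply]
  rw [Matrix.mul_nonsing_inv _ (isUnit_det_kostkaMatrix n), Finset.sum_eq_single lam']
  · simp [lam']
  · intro nu _ hne
    rw [Matrix.one_apply_ne hne.symm, zero_smul]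
  · simp

/-- Expanding the left factor in the `t_μ` and moving the integers `K_{λ,μ}` across the tensor sign
collects `∑_λ K_{λ,μ} U_λ = u_μ` on the right. -/
theorem sum_schurU_tmul_schurU (n : ℕ) :
    ∑ lam ∈ partitionsOf n, (schurU lam ⊗ₜ[ℤ] schurU lam : AlgA ⊗[ℤ] AlgA) =
      ∑ lam ∈ partitionsOf n, tPart lam ⊗ₜ[ℤ] uPart lam := by
  have h1 : ∀ lam ∈ partitionsOf n, (schurU lam ⊗ₜ[ℤ] schurU lam : AlgA ⊗[ℤ] AlgA) =
      ∑ mu ∈ partitionsOf n, tPart mu ⊗ₜ[ℤ] ((kostka lam mu : ℤ) • schurU lam) := by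
    intro lam hlam
    have h2 := schurU_eq_sum_tPart lam
    rw [mem_partitionsOf.1 hlam] at h2
    generalize schurU lam = w at h2 ⊢
    nth_rewrite 1 [h2]
    rw [TensorProduct.sum_tmul]
    exact Finset.sum_congr rfl fun mu _ => TensorProduct.smul_tmul _ _ _
  rw [Finset.sum_congr rfl h1, Finset.sum_comm]
  refine Finset.sum_congr rfl fun mu hmu => ?_
  rw [← TensorProduct.tmul_sum, uPart_eq_sum_kostka, mem_partitionsOf.1 hmu]

theorem omega_uInt (r : ℤ) : omega (uInt r) = vInt r := by
  rcases lt_or_ge r 0 with h | h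
  · rw [uInt_of_neg h, map_zero, vInt, if_pos h]
  · obtain ⟨n, rfl⟩ := Int.eq_ofNat_of_zero_le h
    cases n with
    | zero => simp [vInt]
    | succ n =>
      rw [Nat.cast_succ, uInt_succ, omega, MvPolynomial.aeval_X]

theorem omega_uPart (lam : YoungDiagram) : omega (uPart lam) = vPart lam := by
  simp only [uPart, uVec, map_prod, omega_uInt, vPart]

theorem sum_schurU_tmul_schurV (n : ℕ) :
    ∑ lam ∈ partitionsOf n, (schurU lam ⊗ₜ[ℤ] schurV lam : AlgA ⊗[ℤ] AlgA) =
      ∑ lam ∈ partitionsOf n, tPart lam ⊗ₜ[ℤ] vPart lam := by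
  have h := congrArg (Algebra.TensorProduct.map (AlgHom.id ℤ AlgA) omega)
    (sum_schurU_tmul_schurU n)
  simpa [map_sum, omega_uPart, schurV] using h

end KostkaMatrix

/-! ### Setting variables to zero -/

section Restriction

variable {σ : Type*}

/-- The ring homomorphism which sets the variables outside `S` to zero. -/
noncomputable def restrictVars (S : Set σ) : MvPowerSeries σ ℤ →ₐ[ℤ] MvPowerSeries σ ℤ :=
  (MvPowerSeries.rename (Function.Embedding.subtype (· ∈ S))).comp
    (MvPowerSeries.killCompl (Function.Embedding.subtype (· ∈ S)))

theorem coeff_restrictVars_of_forall {S : Set σ} {d : σ →₀ ℕ} (hd : ∀ i, i ∉ S → d i = 0)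
    (p : MvPowerSeries σ ℤ) :
    MvPowerSeries.coeff d (restrictVars S p) = MvPowerSeries.coeff d p := by
  have h : d = Finsupp.embDomain (Function.Embedding.subtype (· ∈ S))
      (d.comapDomain (Function.Embedding.subtype (· ∈ S))
        (Function.Embedding.subtype (· ∈ S)).injective.injOn) := by
    rw [Finsupp.embDomain_comapDomain]
    intro i hi
    by_contra hne
    refine Finsupp.mem_support_iff.1 hi (hd i fun hS => hne ⟨⟨i, hS⟩, rfl⟩)
  conv_lhs => rw [h]
  rw [restrictVars, AlgHom.comp_apply, MvPowerSeries.coeff_embDomain_rename,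
    MvPowerSeries.coeff_killCompl, ← h]

theorem coeff_restrictVars_of_exists {S : Set σ} {d : σ →₀ ℕ} (hd : ∃ i, i ∉ S ∧ d i ≠ 0)
    (p : MvPowerSeries σ ℤ) : MvPowerSeries.coeff d (restrictVars S p) = 0 := by
  rw [restrictVars, AlgHom.comp_apply, MvPowerSeries.coeff_rename_eq_zero]
  rintro ⟨x, rfl⟩
  obtain ⟨i, hi, hne⟩ := hd
  refine hne (Finsupp.mapDomain_of_notMem_range _ _ ?_)
  rintro ⟨j, rfl⟩
  exact hi j.2

open Classical in
theorem coeff_restrictVars (S : Set σ) (d : σ →₀ ℕ) (p : MvPowerSeries σ ℤ) :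
    MvPowerSeries.coeff d (restrictVars S p) =
      if ∀ i, i ∉ S → d i = 0 then MvPowerSeries.coeff d p else 0 := by
  split_ifs with h
  · exact coeff_restrictVars_of_forall h p
  · push Not at h
    exact coeff_restrictVars_of_exists h p

end Restriction

/-! ### Coefficients of Schur functions -/

section SchurFunctions

@[simp]
theorem coeff_hSym (r : ℕ) (d : ℕ →₀ ℕ) :
    MvPowerSeries.coeff d (hSym r : MvPowerSeries ℕ ℤ) = if d.degree = r then 1 else 0 := rfl

theorem hSym_zero : hSym 0 = 1 := by
  refine Subtype.ext (MvPowerSeries.ext fun d => ?_)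
  rw [coeff_hSym, OneMemClass.coe_one, MvPowerSeries.coeff_one]
  simp only [Finsupp.degree_eq_zero_iff]

theorem phi_uInt (r : ℕ) : phi (uInt r) = hSym r := by
  cases r with
  | zero => rw [Nat.cast_zero, uInt_zero, map_one, hSym_zero]
  | succ r => rw [Nat.cast_succ, uInt_succ, phi, MvPolynomial.aeval_X]

/-- The ring homomorphism sending `u_r` to the complete symmetric polynomial in the first `n`
variables. -/
noncomputable def phiRestrict (n : ℕ) : AlgA →+* MvPowerSeries ℕ ℤ :=
  (restrictVars (Set.Iio n)).toRingHom.comp (Lam.subtype.comp phi.toRingHom)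

theorem coeff_phiRestrict (n : ℕ) (d : ℕ →₀ ℕ) (p : AlgA) [Decidable (∀ i, n ≤ i → d i = 0)] :
    MvPowerSeries.coeff d (phiRestrict n p) =
      if ∀ i, n ≤ i → d i = 0 then MvPowerSeries.coeff d (phi p : MvPowerSeries ℕ ℤ) else 0 := by
  have h := coeff_restrictVars (Set.Iio n) d (phi p : MvPowerSeries ℕ ℤ)
  simp only [Set.mem_Iio, not_lt] at h
  refine Eq.trans h ?_
  congr

open Classical in
theorem coeff_phiRestrict_uInt (n : ℕ) (d : ℕ →₀ ℕ) (r : ℤ) :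
    MvPowerSeries.coeff d (phiRestrict n (uInt r)) =
      if (∀ i, n ≤ i → d i = 0) ∧ (d.degree : ℤ) = r then 1 else 0 := by
  rw [coeff_phiRestrict]
  rcases lt_or_ge r 0 with h | h
  · rw [uInt_of_neg h, map_zero, if_neg (c := _ ∧ _) (by lia)]
    simp
  · obtain ⟨m, rfl⟩ := Int.eq_ofNat_of_zero_le h
    rw [phi_uInt, coeff_hSym]
    simp only [Nat.cast_inj, ite_and]

theorem coeff_X_pow_mul' (n k : ℕ) (d : ℕ →₀ ℕ) (f : MvPowerSeries ℕ ℤ) :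
    MvPowerSeries.coeff d (MvPowerSeries.X n ^ k * f) =
      if k ≤ d n then MvPowerSeries.coeff (d - Finsupp.single n k) f else 0 := by
  rw [MvPowerSeries.X_pow_eq, MvPowerSeries.coeff_monomial_mul, one_mul]
  simp only [Finsupp.single_le_iff]

theorem degree_sub_single {d : ℕ →₀ ℕ} {n k : ℕ} (h : k ≤ d n) :
    (d - Finsupp.single n k).degree + k = d.degree := by
  conv_rhs => rw [← tsub_add_cancel_of_le (Finsupp.single_le_iff.2 h), map_add,
    Finsupp.degree_single]

/-- A monomial of degree `r` in the first `n + 1` variables either avoids the last variable or is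
divisible by it. -/
theorem phiRestrict_succ_uInt (n : ℕ) (r : ℤ) :
    phiRestrict (n + 1) (uInt r) = phiRestrict n (uInt r) +
      MvPowerSeries.X n * phiRestrict (n + 1) (uInt (r - 1)) := by
  classical
  ext d
  have hX := coeff_X_pow_mul' n 1 d (phiRestrict (n + 1) (uInt (r - 1)))
  rw [pow_one] at hX
  rw [map_add, hX]
  simp only [coeff_phiRestrict_uInt]
  rcases Nat.eq_zero_or_pos (d n) with h0 | hpos
  · rw [if_neg (c := 1 ≤ d n) (by lia), add_zero]
    refine if_congr (and_congr_left fun _ => ?_) rfl rfl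
    constructor
    · intro h i hi
      rcases hi.eq_or_lt with rfl | hlt
      · exact h0
      · exact h i hlt
    · exact fun h i hi => h i (by lia)
  · rw [if_pos (c := 1 ≤ d n) hpos, if_neg (c := (∀ i, n ≤ i → d i = 0) ∧ _)
      (fun h => hpos.ne' (h.1 n le_rfl)), zero_add]
    have hdeg := degree_sub_single (d := d) (n := n) (k := 1) hpos
    refine if_congr (and_congr (forall_congr' fun i => imp_congr_right fun hi => ?_) ?_) rfl rfl
    · rw [Finsupp.tsub_apply, Finsupp.single_eq_of_ne (by lia), tsub_zero]
    · lia

theorem stripChains_congr {α β : ℕ → ℕ} {n : ℕ} (h : ∀ i < n, α i = β i) (lam : YoungDiagram) :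
    stripChains α n lam = stripChains β n lam := by
  induction n generalizing lam with
  | zero => rfl
  | succ n ih =>
    rw [stripChains, stripChains, h n (Nat.lt_succ_self n)]
    exact Finset.sum_congr rfl fun nu _ => ih (fun i hi => h i (hi.trans (Nat.lt_succ_self n))) nu

theorem jacobiTrudi_of_forall_ne_zero {R : Type*} [CommRing R] {g : ℤ → R}
    (h : ∀ r, r ≠ 0 → g r = 0) (lam : YoungDiagram) :
    jacobiTrudi g (lam.colLen 0) lam.rowLen = if lam.card = 0 then 1 else 0 := by
  split_ifs with hc
  · obtain rfl := eq_bot_of_card_eq_zero hc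
    have h1 : (⊥ : YoungDiagram).colLen 0 = 0 := by
      rw [YoungDiagram.colLen_eq_card]
      simp [YoungDiagram.col]
    rw [h1]
    simp [jacobiTrudi]
  · have hpos : 0 < lam.colLen 0 := by
      by_contra! hle
      exact hc (by rw [card_eq_sum_rowLen (rowLen_eq_zero_iff.2 hle)]; simp)
    refine Matrix.det_eq_zero_of_row_eq_zero ⟨0, hpos⟩ fun j => h _ ?_
    have : lam.rowLen 0 ≠ 0 := fun h => by
      rw [rowLen_eq_zero_iff] at h
      lia
    simp only [Nat.cast_zero]
    lia

theorem phiRestrict_zero_uInt {r : ℤ} (hr : r ≠ 0) : phiRestrict 0 (uInt r) = 0 := by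
  classical
  ext d
  rw [coeff_phiRestrict_uInt, if_neg, map_zero]
  rintro ⟨h, h'⟩
  have : d = 0 := Finsupp.ext fun i => h i (Nat.zero_le i)
  rw [this, map_zero] at h'
  exact hr h'.symm

open Classical in
-- Induction on the number of variables: by branching, the last variable with exponent `d n` peels
-- off a horizontal strip of size `d n`. The count `stripChains` is the one produced by the Pieri
-- rule.
theorem coeff_phiRestrict_schurU (n : ℕ) (d : ℕ →₀ ℕ) (lam : YoungDiagram) :
    MvPowerSeries.coeff d (phiRestrict n (schurU lam)) =
      if ∀ i, n ≤ i → d i = 0 then (stripChains d n lam : ℤ) else 0 := by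
  induction n generalizing d lam with
  | zero =>
    rw [map_schurU _ (rowLen_eq_zero_iff.2 (le_refl (lam.colLen 0))),
      jacobiTrudi_of_forall_ne_zero fun r => phiRestrict_zero_uInt]
    have hd : (∀ i, 0 ≤ i → d i = 0) ↔ d = 0 := by
      rw [Finsupp.ext_iff]
      simp
    simp only [hd, stripChains]
    by_cases hc : lam.card = 0 <;> simp [hc, MvPowerSeries.coeff_one]
  | succ n ih =>
    rw [map_schurU_branching (phiRestrict n) (phiRestrict (n + 1)) (phiRestrict_succ_uInt n),
      map_sum, stripChains, Finset.sum_filter]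
    simp only [coeff_X_pow_mul', ih]
    have hcond : ∀ k, (∀ i, n ≤ i → (d - Finsupp.single n k) i = 0) ↔
        d n ≤ k ∧ ∀ i, n + 1 ≤ i → d i = 0 := by
      intro k
      simp only [Finsupp.tsub_apply]
      constructor
      · intro h
        refine ⟨by simpa [tsub_eq_zero_iff_le] using h n le_rfl, fun i hi => ?_⟩
        have := h i (by lia)
        rwa [Finsupp.single_eq_of_ne (by lia), tsub_zero] at this
      · rintro ⟨h1, h2⟩ i hi
        rcases hi.eq_or_lt with rfl | hlt
        · rw [Finsupp.single_eq_same]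
          lia
        · rw [h2 i hlt, zero_tsub]
    simp only [hcond]
    split_ifs with hd
    · rw [Nat.cast_sum]
      refine Finset.sum_congr rfl fun nu hnu => ?_
      have hle := card_le_card_of_le (mem_stripsBelow.1 hnu).1
      -- A larger strip gives a power of the last variable that does not divide the monomial; a
      -- smaller one leaves a power that the remaining variables cannot supply.
      by_cases hk : lam.card - nu.card = d n
      · rw [if_pos hk.le, if_pos ⟨hk.ge, hd⟩, if_pos (by lia),
          stripChains_congr (α := ⇑(d - Finsupp.single n (lam.card - nu.card))) (β := d)]
        intro i hi
        rw [Finsupp.tsub_apply, Finsupp.single_eq_of_ne (by lia), tsub_zero]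
      · rw [if_neg (c := lam.card = nu.card + d n) (by lia), Nat.cast_zero]
        split_ifs with h1 h2
        · lia
        · rfl
        · rfl
    · refine Finset.sum_eq_zero fun nu _ => ?_
      rw [if_neg (c := _ ∧ _) fun h => hd h.2, ite_self]

theorem coeff_sSym {n : ℕ} {d : ℕ →₀ ℕ} (hd : ∀ i, n ≤ i → d i = 0) (lam : YoungDiagram) :
    MvPowerSeries.coeff d (sSym lam : MvPowerSeries ℕ ℤ) = stripChains d n lam := by
  classical
  have h := coeff_phiRestrict_schurU n d lam
  rwa [coeff_phiRestrict, if_pos hd, if_pos hd] at h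

theorem exists_forall_le_eq_zero (d : ℕ →₀ ℕ) : ∃ n, ∀ i, n ≤ i → d i = 0 := by
  obtain ⟨n, hn⟩ := d.support.exists_nat_subset_range
  refine ⟨n, fun i hi => ?_⟩
  by_contra hne
  have := Finset.mem_range.1 (hn (Finsupp.mem_support_iff.2 hne))
  lia

theorem phi_ext_of_phiRestrict {p q : AlgA} (h : ∀ n, phiRestrict n p = phiRestrict n q) :
    phi p = phi q := by
  classical
  refine Subtype.ext (MvPowerSeries.ext fun d => ?_)
  obtain ⟨n, hn⟩ := exists_forall_le_eq_zero d
  have h1 := congrArg (MvPowerSeries.coeff d) (h n)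
  rwa [coeff_phiRestrict, coeff_phiRestrict, if_pos hn, if_pos hn] at h1

end SchurFunctions

/-! ### The involution ω, conjugation and elementary symmetric functions -/

section Dual

theorem vInt_natCast (m : ℕ) : vInt m = jacobiTrudi uInt m fun _ => 1 := by
  cases m with
  | zero => simp [vInt, jacobiTrudi]
  | succ m =>
    rw [vInt, if_neg (by lia), if_neg (by lia), schurVec_eq_det]
    rfl

theorem vInt_of_neg {r : ℤ} (h : r < 0) : vInt r = 0 := if_pos h

@[simp]
theorem vInt_zero : vInt 0 = 1 := by simp [vInt]

theorem exists_column (m : ℕ) :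
    ∃ c : YoungDiagram, ∀ i, c.rowLen i = if i < m then 1 else 0 := by
  refine exists_rowLen_eq (N := m) (fun a b hab => ?_) (by simp)
  split_ifs <;> lia

theorem schurU_column {m : ℕ} {c : YoungDiagram} (hc : ∀ i, c.rowLen i = if i < m then 1 else 0) :
    schurU c = vInt m := by
  rw [schurU_eq_jacobiTrudi (N := m) (by simp [hc]), vInt_natCast]
  exact jacobiTrudi_congr _ fun i hi => by rw [hc, if_pos hi]

theorem card_column {m : ℕ} {c : YoungDiagram} (hc : ∀ i, c.rowLen i = if i < m then 1 else 0) :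
    c.card = m := by
  rw [card_eq_sum_rowLen (N := m) (by simp [hc]),
    Finset.sum_congr rfl fun i hi => by rw [hc, if_pos (Finset.mem_range.1 hi)]]
  simp

/-- Removing a horizontal strip from a column removes at most its bottom cell, so the branching sum
for `(1^r)` has only two terms. -/
theorem map_vInt_branching {R F F' : Type*} [CommRing R] [FunLike F AlgA R]
    [RingHomClass F AlgA R] [FunLike F' AlgA R] [RingHomClass F' AlgA R] (φ : F) (φ' : F') {z : R}
    (h : ∀ r, φ' (uInt r) = φ (uInt r) + z * φ' (uInt (r - 1))) (r : ℤ) :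
    φ' (vInt r) = φ (vInt r) + z * φ (vInt (r - 1)) := by
  classical
  rcases lt_or_ge r 0 with hr | hr
  · simp [vInt_of_neg hr, vInt_of_neg (show r - 1 < 0 by lia)]
  · obtain ⟨m, rfl⟩ := Int.eq_ofNat_of_zero_le hr
    cases m with
    | zero => simp [vInt_of_neg]
    | succ m =>
      obtain ⟨c, hc⟩ := exists_column (m + 1)
      obtain ⟨c', hc'⟩ := exists_column m
      have hne : c ≠ c' := fun h => by
        have := card_column hc
        rw [h, card_column hc'] at this
        lia
      have hstrips : stripsBelow c = {c, c'} := by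
        ext nu
        rw [mem_stripsBelow, isStrip_iff, Finset.mem_insert, Finset.mem_singleton]
        constructor
        · intro hs
          by_cases hm : nu.rowLen m = 0
          · refine Or.inr (rowLen_injective fun i => ?_)
            have h1 := hs i
            have h2 := fun h : m ≤ i => antitone_rowLen nu h
            rw [hc, hc] at h1
            rw [hc']
            split_ifs at h1 ⊢ <;> lia
          · refine Or.inl (rowLen_injective fun i => ?_)
            have h1 := hs i
            have h2 := fun h : i ≤ m => antitone_rowLen nu h
            rw [hc, hc] at h1
            rw [hc]
            split_ifs at h1 ⊢ <;> lia
        · rintro (rfl | rfl) i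
          · rw [hc, hc]
            split_ifs <;> lia
          · rw [hc, hc, hc']
            split_ifs <;> lia
      rw [← schurU_column hc, map_schurU_branching φ φ' h, hstrips, Finset.sum_pair hne,
        card_column hc, card_column hc', Nat.sub_self, pow_zero, one_mul,
        Nat.add_sub_cancel_left, pow_one, schurU_column hc']
      congr 4
      push_cast; ring

theorem phiRestrict_zero_vInt {r : ℤ} (hr : r ≠ 0) : phiRestrict 0 (vInt r) = 0 := by
  rcases lt_or_ge r 0 with h | h
  · rw [vInt_of_neg h, map_zero]
  · obtain ⟨m, rfl⟩ := Int.eq_ofNat_of_zero_le h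
    obtain ⟨c, hc⟩ := exists_column m
    rw [← schurU_column hc, map_schurU _ (rowLen_eq_zero_iff.2 (le_refl (c.colLen 0))),
      jacobiTrudi_of_forall_ne_zero fun r => phiRestrict_zero_uInt, card_column hc,
      if_neg (by lia)]

theorem map_schurV {R F : Type*} [CommRing R] [FunLike F AlgA R] [RingHomClass F AlgA R] (φ : F)
    (lam : YoungDiagram) :
    φ (schurV lam) = jacobiTrudi (fun r => φ (vInt r)) (lam.colLen 0) lam.rowLen := by
  rw [schurV, map_schurU _ (rowLen_eq_zero_iff.2 (le_refl (lam.colLen 0))), map_jacobiTrudi]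
  simp only [omega_uInt]

/-- Under a new variable, `V_λ`, as the Jacobi–Trudi determinant in the `v_r`, loses a vertical
strip of `λ`, and `U_{λ'}` loses a horizontal strip of `λ'`. Both satisfy the same recursion and
agree when there are no variables. -/
theorem phiRestrict_schurV (n : ℕ) (lam : YoungDiagram) :
    phiRestrict n (schurV lam) = phiRestrict n (schurU lam.transpose) := by
  induction n generalizing lam with
  | zero =>
    rw [map_schurV, map_schurU _ (rowLen_eq_zero_iff.2 (le_refl (lam.transpose.colLen 0))),
      jacobiTrudi_of_forall_ne_zero fun r => phiRestrict_zero_uInt,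
      jacobiTrudi_of_forall_ne_zero fun r => phiRestrict_zero_vInt, card_transpose]
  | succ n ih =>
    rw [map_schurV, jacobiTrudi_branching_strips (g := fun r => phiRestrict n (vInt r))
      (fun r hr => by rw [vInt_of_neg hr, map_zero]) (by simp)
      (map_vInt_branching (phiRestrict n) (phiRestrict (n + 1)) (phiRestrict_succ_uInt n)),
      map_schurU_branching (phiRestrict n) (phiRestrict (n + 1)) (phiRestrict_succ_uInt n)]
    refine Finset.sum_congr rfl fun nu _ => ?_
    rw [← map_schurV, ih, YoungDiagram.transpose_transpose, card_transpose]

theorem phi_schurV (lam : YoungDiagram) : phi (schurV lam) = sSym lam.transpose :=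
  phi_ext_of_phiRestrict fun n => phiRestrict_schurV n lam

open Classical in
theorem coeff_phiRestrict_vInt (n : ℕ) (d : ℕ →₀ ℕ) (r : ℤ) :
    MvPowerSeries.coeff d (phiRestrict n (vInt r)) =
      if (∀ i, n ≤ i → d i = 0) ∧ (d.degree : ℤ) = r ∧ ∀ i, d i ≤ 1 then 1 else 0 := by
  induction n generalizing d r with
  | zero =>
    by_cases hr : r = 0
    · subst hr
      rw [vInt_zero, map_one, MvPowerSeries.coeff_one]
      refine if_congr ⟨?_, ?_⟩ rfl rfl
      · rintro rfl
        simp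
      · rintro ⟨h, -⟩
        exact Finsupp.ext fun i => h i (Nat.zero_le i)
    · rw [phiRestrict_zero_vInt hr, map_zero, if_neg]
      rintro ⟨h, h', -⟩
      have : d = 0 := Finsupp.ext fun i => h i (Nat.zero_le i)
      rw [this, map_zero] at h'
      exact hr h'.symm
  | succ n ih =>
    have hX := coeff_X_pow_mul' n 1 d (phiRestrict n (vInt (r - 1)))
    rw [pow_one] at hX
    rw [map_vInt_branching (phiRestrict n) (phiRestrict (n + 1)) (phiRestrict_succ_uInt n),
      map_add, hX, ih, ih]
    rcases Nat.eq_zero_or_pos (d n) with h0 | hpos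
    · rw [if_neg (c := 1 ≤ d n) (by lia), add_zero]
      refine if_congr (and_congr_left fun _ => ?_) rfl rfl
      constructor
      · exact fun h i hi => h i (by lia)
      · intro h i hi
        rcases hi.eq_or_lt with rfl | hlt
        · exact h0
        · exact h i hlt
    · rw [if_pos (c := 1 ≤ d n) hpos, if_neg (c := (∀ i, n ≤ i → d i = 0) ∧ _)
        (fun h => hpos.ne' (h.1 n le_rfl)), zero_add]
      have hdeg := degree_sub_single (d := d) (n := n) (k := 1) hpos
      have hne : ∀ i, i ≠ n → (d - Finsupp.single n 1 : ℕ →₀ ℕ) i = d i := fun i hi => by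
        rw [Finsupp.tsub_apply, Finsupp.single_eq_of_ne hi, tsub_zero]
      have heq : (d - Finsupp.single n 1 : ℕ →₀ ℕ) n = d n - 1 := by
        rw [Finsupp.tsub_apply, Finsupp.single_eq_same]
      refine if_congr ⟨?_, ?_⟩ rfl rfl
      · rintro ⟨h1, h2, h3⟩
        refine ⟨fun i hi => ?_, by lia, fun i => ?_⟩
        · rw [← hne i (by lia)]
          exact h1 i (by lia)
        · by_cases hi : i = n
          · have := h1 n le_rfl
            subst hi
            lia
          · rw [← hne i hi]
            exact h3 i
      · rintro ⟨h1, h2, h3⟩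
        refine ⟨fun i hi => ?_, by lia, fun i => ?_⟩
        · rcases hi.eq_or_lt with rfl | hlt
          · have := h3 n
            lia
          · rw [hne i (by lia)]
            exact h1 i hlt
        · by_cases hi : i = n
          · have := h3 n
            subst hi
            lia
          · rw [hne i hi]
            exact h3 i

open Classical in
theorem coeff_eSym (r : ℕ) (d : ℕ →₀ ℕ) :
    MvPowerSeries.coeff d (eSym r : MvPowerSeries ℕ ℤ) =
      if d.degree = r ∧ ∀ i, d i ≤ 1 then 1 else 0 := rfl

theorem phi_vInt (r : ℕ) : phi (vInt r) = eSym r := by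
  classical
  refine Subtype.ext (MvPowerSeries.ext fun d => ?_)
  obtain ⟨n, hn⟩ := exists_forall_le_eq_zero d
  have h := coeff_phiRestrict_vInt n d r
  rw [coeff_phiRestrict, if_pos hn] at h
  rw [h, coeff_eSym]
  exact if_congr (by rw [and_iff_right hn, Nat.cast_inj]) rfl rfl

end Dual

/-! ### Power series in two alphabets and convergence of the products -/

section TwoAlphabets

/-- The exponents of the variables `x`. -/
noncomputable def xPart (D : ℕ ⊕ ℕ →₀ ℕ) : ℕ →₀ ℕ :=
  D.comapDomain Sum.inl Sum.inl_injective.injOn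

/-- The exponents of the variables `y`. -/
noncomputable def yPart (D : ℕ ⊕ ℕ →₀ ℕ) : ℕ →₀ ℕ :=
  D.comapDomain Sum.inr Sum.inr_injective.injOn

@[simp]
theorem xPart_apply (D : ℕ ⊕ ℕ →₀ ℕ) (i : ℕ) : xPart D i = D (Sum.inl i) := rfl

@[simp]
theorem yPart_apply (D : ℕ ⊕ ℕ →₀ ℕ) (i : ℕ) : yPart D i = D (Sum.inr i) := rfl

theorem eq_of_xPart_of_yPart {D E : ℕ ⊕ ℕ →₀ ℕ} (hx : ∀ i, D (Sum.inl i) = E (Sum.inl i))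
    (hy : ∀ i, D (Sum.inr i) = E (Sum.inr i)) : D = E := by
  ext (i | i)
  · exact hx i
  · exact hy i

theorem coeff_rename_inl_mul_rename_inr (p q : MvPowerSeries ℕ ℤ) (D : ℕ ⊕ ℕ →₀ ℕ) :
    MvPowerSeries.coeff D (MvPowerSeries.rename (Function.Embedding.inl : ℕ ↪ ℕ ⊕ ℕ) p *
        MvPowerSeries.rename (Function.Embedding.inr : ℕ ↪ ℕ ⊕ ℕ) q) =
      MvPowerSeries.coeff (xPart D) p * MvPowerSeries.coeff (yPart D) q := by
  classical
  set d := Finsupp.embDomain (Function.Embedding.inl : ℕ ↪ ℕ ⊕ ℕ) (xPart D) with hd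
  set e := Finsupp.embDomain (Function.Embedding.inr : ℕ ↪ ℕ ⊕ ℕ) (yPart D) with he
  have hsum : d + e = D := eq_of_xPart_of_yPart
    (fun i => by simp [hd, he]) (fun i => by simp [hd, he])
  rw [MvPowerSeries.coeff_mul, Finset.sum_eq_single (d, e)]
  · simp only [hd, he, MvPowerSeries.coeff_embDomain_rename]
  · rintro ⟨a, b⟩ hab hne
    rw [Finset.HasAntidiagonal.mem_antidiagonal] at hab
    by_cases ha : a ∈ Set.range (Finsupp.mapDomain (Function.Embedding.inl : ℕ ↪ ℕ ⊕ ℕ))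
    · by_cases hb : b ∈ Set.range (Finsupp.mapDomain (Function.Embedding.inr : ℕ ↪ ℕ ⊕ ℕ))
      · obtain ⟨a, rfl⟩ := ha
        obtain ⟨b, rfl⟩ := hb
        rw [← Finsupp.embDomain_eq_mapDomain, ← Finsupp.embDomain_eq_mapDomain] at hab
        have h1 : a = xPart D := by
          ext i
          rw [← hab]
          simp
        have h2 : b = yPart D := by
          ext i
          rw [← hab]
          simp
        refine (hne ?_).elim
        rw [← Finsupp.embDomain_eq_mapDomain, ← Finsupp.embDomain_eq_mapDomain, hd, he, h1, h2]
      · simp only [MvPowerSeries.coeff_rename_eq_zero _ _ hb, mul_zero]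
    · simp only [MvPowerSeries.coeff_rename_eq_zero _ _ ha, zero_mul]
  · intro h
    exact (h (Finset.HasAntidiagonal.mem_antidiagonal.2 hsum)).elim

theorem coeff_inX_mul_inY (f g : Lam) (D : ℕ ⊕ ℕ →₀ ℕ) :
    MvPowerSeries.coeff D (inX f * inY g) =
      MvPowerSeries.coeff (xPart D) (f : MvPowerSeries ℕ ℤ) *
        MvPowerSeries.coeff (yPart D) (g : MvPowerSeries ℕ ℤ) :=
  coeff_rename_inl_mul_rename_inr _ _ D

open Classical in
/-- The series `∑_r x_i^r w_r(y_0, …, y_{n-1})`. -/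
noncomputable def rowSeries (w : ℕ → MvPowerSeries ℕ ℤ) (i n : ℕ) : SeriesXY := fun D =>
  if (∀ k, k ≠ i → D (Sum.inl k) = 0) ∧ ∀ j, n ≤ j → D (Sum.inr j) = 0 then
    MvPowerSeries.coeff (yPart D) (w (D (Sum.inl i))) else 0

open Classical in
theorem coeff_rowSeries (w : ℕ → MvPowerSeries ℕ ℤ) (i n : ℕ) (D : ℕ ⊕ ℕ →₀ ℕ) :
    MvPowerSeries.coeff D (rowSeries w i n) =
      if (∀ k, k ≠ i → D (Sum.inl k) = 0) ∧ ∀ j, n ≤ j → D (Sum.inr j) = 0 then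
        MvPowerSeries.coeff (yPart D) (w (D (Sum.inl i))) else 0 := rfl

theorem coeff_prod_congr {σ ι : Type*} {f g : ι → MvPowerSeries σ ℤ} {s : Finset ι} {D : σ →₀ ℕ}
    (h : ∀ i ∈ s, ∀ a ≤ D, MvPowerSeries.coeff a (f i) = MvPowerSeries.coeff a (g i)) :
    MvPowerSeries.coeff D (∏ i ∈ s, f i) = MvPowerSeries.coeff D (∏ i ∈ s, g i) := by
  classical
  rw [MvPowerSeries.coeff_prod, MvPowerSeries.coeff_prod]
  refine Finset.sum_congr rfl fun l hl => Finset.prod_congr rfl fun i hi => h i hi _ ?_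
  rw [Finset.mem_finsuppAntidiag] at hl
  rw [← hl.1]
  exact Finset.single_le_sum (fun _ _ => zero_le) hi

theorem coeff_prod_rowSeries (w : ℕ → MvPowerSeries ℕ ℤ) {N : ℕ} {D : ℕ ⊕ ℕ →₀ ℕ}
    (hx : ∀ i, N ≤ i → D (Sum.inl i) = 0) (hy : ∀ i, N ≤ i → D (Sum.inr i) = 0) :
    MvPowerSeries.coeff D (∏ i ∈ Finset.range N, rowSeries w i N) =
      MvPowerSeries.coeff (yPart D) (∏ i ∈ Finset.range N, w (D (Sum.inl i))) := by
  classical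
  -- Powers `x_i ^ r` with `r` above the degree of `D` cannot reach the coefficient at `D`, so each
  -- row series may be replaced by a finite sum.
  set R := D.degree + 1 with hR
  have hdeg : ∀ s, D s < R := fun s => Nat.lt_succ_of_le (Finsupp.le_degree s D)
  have h1 : MvPowerSeries.coeff D (∏ i ∈ Finset.range N, rowSeries w i N) =
      MvPowerSeries.coeff D (∏ i ∈ Finset.range N, ∑ r ∈ Finset.range R,
        MvPowerSeries.rename (Function.Embedding.inl : ℕ ↪ ℕ ⊕ ℕ) (MvPowerSeries.X i ^ r) *
          MvPowerSeries.rename (Function.Embedding.inr : ℕ ↪ ℕ ⊕ ℕ) (w r)) := by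
    refine coeff_prod_congr fun i _ a ha => ?_
    rw [coeff_rowSeries, map_sum]
    simp only [coeff_rename_inl_mul_rename_inr, MvPowerSeries.coeff_X_pow]
    have hya : ∀ j, N ≤ j → a (Sum.inr j) = 0 := fun j hj =>
      Nat.le_zero.1 ((ha (Sum.inr j)).trans (hy j hj).le)
    by_cases hcond : ∀ k, k ≠ i → a (Sum.inl k) = 0
    · rw [if_pos ⟨hcond, hya⟩]
      have hxa : xPart a = Finsupp.single i (a (Sum.inl i)) := by
        ext k
        by_cases hk : k = i
        · subst hk
          simp
        · rw [Finsupp.single_eq_of_ne hk, xPart_apply, hcond k hk]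
      rw [Finset.sum_eq_single (a (Sum.inl i))]
      · rw [if_pos hxa, one_mul]
      · intro r _ hr
        rw [hxa, if_neg, zero_mul]
        exact fun h => hr (Finsupp.single_injective i h).symm
      · intro h
        exact (h (Finset.mem_range.2 ((ha _).trans_lt (hdeg _)))).elim
    · rw [if_neg fun h => hcond h.1]
      refine (Finset.sum_eq_zero fun r _ => ?_).symm
      rw [if_neg, zero_mul]
      intro h
      refine hcond fun k hk => ?_
      rw [← xPart_apply, h, Finsupp.single_eq_of_ne hk]
  rw [h1, ← Fin.prod_univ_eq_prod_range (fun i => ∑ r ∈ Finset.range R,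
    MvPowerSeries.rename (Function.Embedding.inl : ℕ ↪ ℕ ⊕ ℕ) (MvPowerSeries.X i ^ r) *
      MvPowerSeries.rename (Function.Embedding.inr : ℕ ↪ ℕ ⊕ ℕ) (w r)) N,
    Finset.prod_univ_sum, map_sum]
  have h2 : ∀ ρ : Fin N → ℕ, MvPowerSeries.coeff D (∏ i : Fin N,
      MvPowerSeries.rename (Function.Embedding.inl : ℕ ↪ ℕ ⊕ ℕ)
          ((MvPowerSeries.X (i : ℕ) : MvPowerSeries ℕ ℤ) ^ ρ i) *
        MvPowerSeries.rename (Function.Embedding.inr : ℕ ↪ ℕ ⊕ ℕ) (w (ρ i))) =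
      if xPart D = ∑ i : Fin N, Finsupp.single (i : ℕ) (ρ i) then
        MvPowerSeries.coeff (yPart D) (∏ i : Fin N, w (ρ i)) else 0 := by
    intro ρ
    rw [Finset.prod_mul_distrib, ← map_prod, ← map_prod, coeff_rename_inl_mul_rename_inr]
    simp only [MvPowerSeries.X_pow_eq]
    rw [MvPowerSeries.prod_monomial, Finset.prod_const_one, MvPowerSeries.coeff_monomial]
    split_ifs <;> simp
  have h3 : ∀ (ρ : Fin N → ℕ) (k : Fin N),
      (∑ i : Fin N, Finsupp.single (i : ℕ) (ρ i)) (k : ℕ) = ρ k := by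
    intro ρ k
    rw [Finsupp.finsetSum_apply, Finset.sum_eq_single k]
    · simp
    · intro i _ hi
      exact Finsupp.single_eq_of_ne fun h => hi (Fin.ext h.symm)
    · simp
  simp only [h2]
  rw [Finset.sum_eq_single fun i : Fin N => D (Sum.inl i)]
  · rw [if_pos, Fin.prod_univ_eq_prod_range (fun i => w (D (Sum.inl i)))]
    ext k
    by_cases hk : k < N
    · exact (h3 (fun i => D (Sum.inl i)) ⟨k, hk⟩).symm
    · rw [xPart_apply, hx k (not_lt.1 hk), Finsupp.finsetSum_apply]
      refine (Finset.sum_eq_zero fun i _ => Finsupp.single_eq_of_ne ?_).symm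
      have := i.2
      lia
  · intro ρ _ hρ
    rw [if_neg]
    intro h
    refine hρ (funext fun k => ?_)
    rw [← h3 ρ k, ← h, xPart_apply]
  · intro h
    exact (h (Fintype.mem_piFinset.2 fun i => Finset.mem_range.2 (hdeg _))).elim

/-- The coefficient at `D` is unchanged when the variables outside a finite set containing the
support of `D` are set to zero. This turns every factor outside an `N × N` square into 1, so the
coefficient is the same for all finite products containing the square. The square splits into rows,
each built from 1 by adjoining one `y` at a time. -/
theorem hasProd_of_rowSeries {f : ℕ × ℕ → SeriesXY} {w : ℕ → MvPowerSeries ℕ ℤ} {P : SeriesXY}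
    (hnot : ∀ S i j, Sum.inl i ∉ S ∨ Sum.inr j ∉ S → restrictVars S (f (i, j)) = 1)
    (hrow : ∀ i n, rowSeries w i (n + 1) = f (i, n) * rowSeries w i n)
    (hw : ∀ r, MvPowerSeries.coeff 0 (w r) = if r = 0 then 1 else 0)
    (hP : ∀ (D : ℕ ⊕ ℕ →₀ ℕ) N, (∀ i, N ≤ i → D (Sum.inl i) = 0) →
      (∀ i, N ≤ i → D (Sum.inr i) = 0) → MvPowerSeries.coeff D P =
        MvPowerSeries.coeff (yPart D) (∏ i ∈ Finset.range N, w (D (Sum.inl i)))) :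
    HasProd f P := by
  classical
  have hrow0 : ∀ i, rowSeries w i 0 = 1 := by
    intro i
    ext D
    rw [coeff_rowSeries, MvPowerSeries.coeff_one]
    split_ifs with h1 h2 h2
    · subst h2
      have : yPart 0 = 0 := Finsupp.ext fun _ => rfl
      rw [this, hw, Finsupp.zero_apply, if_pos rfl]
    · have h3 : yPart D = 0 := Finsupp.ext fun j => h1.2 j (Nat.zero_le j)
      rw [h3, hw, if_neg]
      intro h4
      refine h2 (eq_of_xPart_of_yPart (fun k => ?_) fun j => h1.2 j (Nat.zero_le j))
      by_cases hk : k = i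
      · rw [hk, h4, Finsupp.zero_apply]
      · exact h1.1 k hk
    · exact (h1 (by simp [h2])).elim
    · rfl
  have hrowprod : ∀ i n, rowSeries w i n = ∏ j ∈ Finset.range n, f (i, j) := by
    intro i n
    induction n with
    | zero => simp [hrow0]
    | succ n ih => rw [hrow, ih, Finset.prod_range_succ, mul_comm]
  rw [HasProd, SummationFilter.unconditional_filter,
    MvPowerSeries.WithPiTopology.tendsto_iff_coeff_tendsto]
  intro D
  obtain ⟨N1, hN1⟩ := exists_forall_le_eq_zero (xPart D)
  obtain ⟨N2, hN2⟩ := exists_forall_le_eq_zero (yPart D)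
  set N := max N1 N2 with hN
  have hx : ∀ i, N ≤ i → D (Sum.inl i) = 0 := fun i hi => hN1 i (by lia)
  have hy : ∀ i, N ≤ i → D (Sum.inr i) = 0 := fun i hi => hN2 i (by lia)
  refine tendsto_const_nhds.congr' ?_
  filter_upwards [Filter.eventually_ge_atTop (Finset.range N ×ˢ Finset.range N)] with T hT
  set S : Set (ℕ ⊕ ℕ) := {s | Sum.elim (· < N) (· < N) s} with hS
  have hDS : ∀ s, s ∉ S → D s = 0 := by
    rintro (i | i) hi
    · exact hx i (not_lt.1 hi)
    · exact hy i (not_lt.1 hi)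
  have h1 : restrictVars S (∏ p ∈ T, f p) =
      restrictVars S (∏ p ∈ Finset.range N ×ˢ Finset.range N, f p) := by
    rw [map_prod, map_prod]
    symm
    refine Finset.prod_subset hT ?_
    rintro ⟨i, j⟩ _ hij
    refine hnot S i j ?_
    by_contra! h
    exact hij (Finset.mk_mem_product (Finset.mem_range.2 h.1) (Finset.mem_range.2 h.2))
  rw [← coeff_restrictVars_of_forall hDS (∏ p ∈ T, f p), h1, coeff_restrictVars_of_forall hDS,
    Finset.prod_product, hP D N hx hy, ← coeff_prod_rowSeries w hx hy]
  simp only [hrowprod]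

end TwoAlphabets

/-! ### The factors of the two Cauchy products -/

section Factors

theorem restrictVars_X_of_notMem {σ : Type*} {S : Set σ} {s : σ} (h : s ∉ S) :
    restrictVars S (MvPowerSeries.X s) = 0 := by
  classical
  ext d
  rw [coeff_restrictVars, map_zero]
  split_ifs with hd
  · rw [MvPowerSeries.coeff_X, if_neg]
    rintro rfl
    simpa using hd s h
  · rfl

theorem restrictVars_xy_of_notMem {S : Set (ℕ ⊕ ℕ)} {i j : ℕ}
    (h : Sum.inl i ∉ S ∨ Sum.inr j ∉ S) : restrictVars S (xy i j) = 0 := by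
  rw [xy, map_mul]
  rcases h with h | h
  · rw [restrictVars_X_of_notMem h, zero_mul]
  · rw [restrictVars_X_of_notMem h, mul_zero]

theorem restrictVars_cauchyFactor_of_notMem {S : Set (ℕ ⊕ ℕ)} {i j : ℕ}
    (h : Sum.inl i ∉ S ∨ Sum.inr j ∉ S) : restrictVars S (cauchyFactor i j) = 1 := by
  have h' := congrArg (restrictVars S) (mul_cauchyFactor i j)
  rwa [map_mul, map_sub, map_one, restrictVars_xy_of_notMem h, sub_zero, one_mul] at h'

theorem coeff_xy_mul (i n : ℕ) (f : SeriesXY) (D : ℕ ⊕ ℕ →₀ ℕ) :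
    MvPowerSeries.coeff D (xy i n * f) =
      if 1 ≤ D (Sum.inl i) ∧ 1 ≤ D (Sum.inr n) then
        MvPowerSeries.coeff (D - (Finsupp.single (Sum.inl i) 1 + Finsupp.single (Sum.inr n) 1)) f
      else 0 := by
  rw [xy, MvPowerSeries.X_def, MvPowerSeries.X_def, MvPowerSeries.monomial_mul_monomial,
    mul_one, MvPowerSeries.coeff_monomial_mul, one_mul]
  refine if_congr ⟨fun h => ⟨?_, ?_⟩, ?_⟩ rfl rfl
  · simpa using h (Sum.inl i)
  · simpa using h (Sum.inr n)
  · rintro ⟨h1, h2⟩ (k | k)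
    · by_cases hk : k = i
      · subst hk
        simpa using h1
      · simp [Ne.symm hk]
    · by_cases hk : k = n
      · subst hk
        simpa using h2
      · simp [Ne.symm hk]

section Sub

variable {D : ℕ ⊕ ℕ →₀ ℕ} {i n : ℕ}

theorem sub_xy_inl_self : (D - (Finsupp.single (Sum.inl i) 1 + Finsupp.single (Sum.inr n) 1) :
    ℕ ⊕ ℕ →₀ ℕ) (Sum.inl i) = D (Sum.inl i) - 1 := by simp

theorem sub_xy_inr_self : (D - (Finsupp.single (Sum.inl i) 1 + Finsupp.single (Sum.inr n) 1) :
    ℕ ⊕ ℕ →₀ ℕ) (Sum.inr n) = D (Sum.inr n) - 1 := by simp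

theorem sub_xy_inl {k : ℕ} (h : k ≠ i) :
    (D - (Finsupp.single (Sum.inl i) 1 + Finsupp.single (Sum.inr n) 1) :
      ℕ ⊕ ℕ →₀ ℕ) (Sum.inl k) = D (Sum.inl k) := by simp [Ne.symm h]

theorem sub_xy_inr {k : ℕ} (h : k ≠ n) :
    (D - (Finsupp.single (Sum.inl i) 1 + Finsupp.single (Sum.inr n) 1) :
      ℕ ⊕ ℕ →₀ ℕ) (Sum.inr k) = D (Sum.inr k) := by simp [Ne.symm h]

theorem yPart_sub_xy :
    yPart (D - (Finsupp.single (Sum.inl i) 1 + Finsupp.single (Sum.inr n) 1)) =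
      yPart D - Finsupp.single n 1 := by
  ext k
  by_cases hk : k = n
  · subst hk
    simp
  · rw [yPart_apply, sub_xy_inr hk, Finsupp.tsub_apply, Finsupp.single_eq_of_ne hk, tsub_zero,
      yPart_apply]

end Sub

/-- Multiplication by `x_i y_n` maps the monomials of the longer row series bijectively onto those
containing `y_n`; subtracting them leaves the shorter row. -/
theorem rowSeries_hSym_succ (i n : ℕ) :
    rowSeries (fun r => (hSym r : MvPowerSeries ℕ ℤ)) i (n + 1) =
      cauchyFactor i n * rowSeries (fun r => (hSym r : MvPowerSeries ℕ ℤ)) i n := by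
  classical
  set w : ℕ → MvPowerSeries ℕ ℤ := fun r => (hSym r : MvPowerSeries ℕ ℤ)
  have h : (1 - xy i n) * rowSeries w i (n + 1) = rowSeries w i n := by
    rw [sub_mul, one_mul, sub_eq_iff_eq_add]
    ext D
    rw [map_add, coeff_xy_mul]
    rcases Nat.eq_zero_or_pos (D (Sum.inr n)) with h0 | hpos
    · rw [if_neg (c := 1 ≤ D (Sum.inl i) ∧ 1 ≤ D (Sum.inr n)) (by lia), add_zero]
      simp only [coeff_rowSeries, w, coeff_hSym, ← ite_and]
      refine if_congr (and_congr_left fun _ => and_congr_right fun _ => ?_) rfl rfl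
      constructor
      · intro h j hj
        rcases hj.eq_or_lt with rfl | hlt
        · exact h0
        · exact h j hlt
      · exact fun h j hj => h j (by lia)
    · have hz : MvPowerSeries.coeff D (rowSeries w i n) = 0 := by
        rw [coeff_rowSeries, if_neg fun h => hpos.ne' (h.2 n le_rfl)]
      rw [hz, zero_add]
      simp only [coeff_rowSeries, w, coeff_hSym, ← ite_and]
      have hdeg := degree_sub_single (d := yPart D) (n := n) (k := 1) hpos
      rw [yPart_sub_xy, sub_xy_inl_self]
      refine if_congr ⟨?_, ?_⟩ rfl rfl
      · rintro ⟨⟨h1, h2⟩, h3⟩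
        refine ⟨⟨by lia, hpos⟩, ⟨fun k hk => ?_, fun j hj => ?_⟩, by lia⟩
        · rw [sub_xy_inl hk, h1 k hk]
        · rw [sub_xy_inr (by lia), h2 j hj]
      · rintro ⟨⟨h1, h2⟩, ⟨h3, h4⟩, h5⟩
        refine ⟨⟨fun k hk => ?_, fun j hj => ?_⟩, by lia⟩
        · rw [← h3 k hk, sub_xy_inl hk]
        · rw [← h4 j hj, sub_xy_inr (by lia)]
  rw [← h, ← mul_assoc, mul_comm (cauchyFactor i n), mul_cauchyFactor, one_mul]

theorem rowSeries_eSym_succ (i n : ℕ) :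
    rowSeries (fun r => (eSym r : MvPowerSeries ℕ ℤ)) i (n + 1) =
      (1 + xy i n) * rowSeries (fun r => (eSym r : MvPowerSeries ℕ ℤ)) i n := by
  classical
  ext D
  rw [add_mul, one_mul, map_add, coeff_xy_mul]
  rcases Nat.eq_zero_or_pos (D (Sum.inr n)) with h0 | hpos
  · rw [if_neg (c := 1 ≤ D (Sum.inl i) ∧ 1 ≤ D (Sum.inr n)) (by lia), add_zero]
    simp only [coeff_rowSeries, coeff_eSym, ← ite_and]
    refine if_congr (and_congr_left fun _ => and_congr_right fun _ => ?_) rfl rfl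
    constructor
    · intro h j hj
      rcases hj.eq_or_lt with rfl | hlt
      · exact h0
      · exact h j hlt
    · exact fun h j hj => h j (by lia)
  · have hz : MvPowerSeries.coeff D (rowSeries (fun r => (eSym r : MvPowerSeries ℕ ℤ)) i n) = 0 := by
      rw [coeff_rowSeries, if_neg fun h => hpos.ne' (h.2 n le_rfl)]
    rw [hz, zero_add]
    simp only [coeff_rowSeries, coeff_eSym, ← ite_and]
    have hdeg := degree_sub_single (d := yPart D) (n := n) (k := 1) hpos
    have hy : ∀ k, k ≠ n → (yPart D - Finsupp.single n 1 : ℕ →₀ ℕ) k = yPart D k := fun k hk => by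
      rw [Finsupp.tsub_apply, Finsupp.single_eq_of_ne hk, tsub_zero]
    have hy' : (yPart D - Finsupp.single n 1 : ℕ →₀ ℕ) n = D (Sum.inr n) - 1 := by simp
    rw [yPart_sub_xy, sub_xy_inl_self]
    refine if_congr ⟨?_, ?_⟩ rfl rfl
    · rintro ⟨⟨h1, h2⟩, h3, h4⟩
      have h5 : D (Sum.inr n) ≤ 1 := h4 n
      refine ⟨⟨by lia, hpos⟩, ⟨fun k hk => ?_, fun j hj => ?_⟩, by lia, fun k => ?_⟩
      · rw [sub_xy_inl hk, h1 k hk]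
      · rcases hj.eq_or_lt with rfl | hlt
        · rw [sub_xy_inr_self]
          lia
        · rw [sub_xy_inr (by lia), h2 j hlt]
      · by_cases hk : k = n
        · subst hk
          lia
        · rw [hy k hk]
          exact h4 k
    · rintro ⟨⟨h1, h2⟩, ⟨h3, h4⟩, h5, h6⟩
      refine ⟨⟨fun k hk => ?_, fun j hj => ?_⟩, by lia, fun k => ?_⟩
      · rw [← h3 k hk, sub_xy_inl hk]
      · rw [← h4 j (by lia), sub_xy_inr (by lia)]
      · by_cases hk : k = n
        · have h7 := h4 n le_rfl
          rw [sub_xy_inr_self] at h7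
          rw [hk, yPart_apply]
          lia
        · rw [← hy k hk]
          exact h6 k

end Factors

/-! ### The Cauchy identities for symmetric functions -/

section CauchyIdentities

/-- The series `∑_α x^α ∏ᵢ θ(u_{αᵢ})(y)`. -/
noncomputable def cauchySeries (θ : AlgA →+* Lam) : SeriesXY := fun D =>
  MvPowerSeries.coeff (yPart D)
    (((xPart D).prod fun _ r => θ (uInt r) : Lam) : MvPowerSeries ℕ ℤ)

theorem coeff_cauchySeries (θ : AlgA →+* Lam) {D : ℕ ⊕ ℕ →₀ ℕ} {N : ℕ}
    (hx : ∀ i, N ≤ i → D (Sum.inl i) = 0) :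
    MvPowerSeries.coeff D (cauchySeries θ) =
      MvPowerSeries.coeff (yPart D)
        (θ (∏ i ∈ Finset.range N, uInt (D (Sum.inl i))) : MvPowerSeries ℕ ℤ) := by
  have h : ((xPart D).prod fun _ r => θ (uInt r) : Lam) =
      θ (∏ i ∈ Finset.range N, uInt (D (Sum.inl i))) := by
    rw [map_prod]
    refine Finsupp.prod_of_support_subset _ (fun i hi => ?_) _ (by simp)
    rw [Finset.mem_range]
    by_contra! hle
    exact Finsupp.mem_support_iff.1 hi (hx i hle)
  rw [← h]
  rfl

theorem coeff_cauchySeries_eq_prod (θ : AlgA →+* Lam) {w : ℕ → Lam} (hw : ∀ r : ℕ, θ (uInt r) = w r)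
    (D : ℕ ⊕ ℕ →₀ ℕ) (N : ℕ) (hx : ∀ i, N ≤ i → D (Sum.inl i) = 0) :
    MvPowerSeries.coeff D (cauchySeries θ) = MvPowerSeries.coeff (yPart D)
      (∏ i ∈ Finset.range N, (w (D (Sum.inl i)) : MvPowerSeries ℕ ℤ)) := by
  rw [coeff_cauchySeries θ hx, map_prod]
  simp only [hw, SubmonoidClass.coe_finsetProd]

/-- One number `stripChains α N λ` is both the coefficient of `x^α` in `s_λ`, by branching, and that
of `U_λ` in `u_α`, by Pieri. It vanishes unless `|λ| = |α|`, so each coefficient is a finite sum. -/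
theorem hasSum_sSym_mul (θ : AlgA →+* Lam) :
    HasSum (fun lam : YoungDiagram => inX (sSym lam) * inY (θ (schurU lam))) (cauchySeries θ) := by
  rw [MvPowerSeries.WithPiTopology.hasSum_iff_hasSum_coeff]
  intro D
  obtain ⟨N, hx⟩ := exists_forall_le_eq_zero (xPart D)
  simp only [coeff_inX_mul_inY, coeff_sSym hx]
  rw [coeff_cauchySeries θ hx]
  have h := prod_uInt_eq_sum (xPart D) N
  simp only [xPart_apply] at h
  rw [h, map_sum, AddSubmonoidClass.coe_finsetSum, map_sum]
  have h1 : ∀ lam, MvPowerSeries.coeff (yPart D)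
      (θ ((stripChains (xPart D) N lam : ℤ) • schurU lam) : MvPowerSeries ℕ ℤ) =
      (stripChains (xPart D) N lam : ℤ) *
        MvPowerSeries.coeff (yPart D) (θ (schurU lam) : MvPowerSeries ℕ ℤ) := by
    intro lam
    rw [map_zsmul, AddSubgroupClass.coe_zsmul, map_zsmul, smul_eq_mul]
  rw [Finset.sum_congr rfl fun lam _ => h1 lam]
  refine hasSum_sum_of_ne_finset_zero fun lam hlam => ?_
  rw [stripChains_eq_zero (α := xPart D) fun h => hlam (mem_partitionsOf.2 h), Nat.cast_zero,
    zero_mul]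

open Classical in
theorem coeff_mSym (lam : YoungDiagram) (d : ℕ →₀ ℕ) :
    MvPowerSeries.coeff d (mSym lam : MvPowerSeries ℕ ℤ) =
      if ∃ s : Equiv.Perm ℕ, ∀ i, d (s i) = lam.rowLen i then 1 else 0 := rfl

/-- Each exponent vector sorts to exactly one partition, so a single `m_λ` contributes to each
coefficient. -/
theorem hasSum_mSym_mul (θ : AlgA →+* Lam) :
    HasSum (fun lam : YoungDiagram => inX (mSym lam) * inY (θ (uPart lam))) (cauchySeries θ) := by
  classical
  rw [MvPowerSeries.WithPiTopology.hasSum_iff_hasSum_coeff]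
  intro D
  obtain ⟨N, hx⟩ := exists_forall_le_eq_zero (xPart D)
  obtain ⟨lam, hN, s, hs⟩ := exists_perm_rowLen_eq hx
  simp only [coeff_inX_mul_inY, coeff_mSym]
  have h : MvPowerSeries.coeff D (cauchySeries θ) =
      (if ∃ s : Equiv.Perm ℕ, ∀ i, xPart D (s i) = lam.rowLen i then 1 else 0) *
        MvPowerSeries.coeff (yPart D) (θ (uPart lam) : MvPowerSeries ℕ ℤ) := by
    rw [if_pos ⟨s, hs⟩, one_mul, coeff_cauchySeries θ hx, uPart_eq_prod hN,
      prod_range_comp_perm (fun r : ℕ => uInt r) (by simp) hx (rowLen_eq_zero_of_le hN) hs]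
    rfl
  rw [h]
  refine hasSum_single lam fun mu hmu => ?_
  rw [if_neg, zero_mul]
  rintro ⟨t, ht⟩
  refine hmu (eq_of_perm_rowLen (s.trans t.symm) fun i => ?_)
  rw [← ht, ← hs]
  simp

theorem prod_partVec_eq {M : Type*} [CommMonoid M] (F : ℤ → M) (lam : YoungDiagram) :
    ∏ i, F (partVec lam i) = ∏ i ∈ Finset.range (lam.colLen 0), F (lam.rowLen i) :=
  Fin.prod_univ_eq_prod_range (fun i => F (lam.rowLen i)) _

theorem phi_uPart (lam : YoungDiagram) : phi (uPart lam) = hPart lam := by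
  rw [uPart, uVec, prod_partVec_eq, map_prod, hPart]
  simp only [phi_uInt]

theorem phi_vPart (lam : YoungDiagram) : phi (vPart lam) = ePart lam := by
  rw [vPart, prod_partVec_eq, map_prod, ePart]
  simp only [phi_vInt]

theorem hasProd_cauchyFactor :
    HasProd (fun p : ℕ × ℕ => cauchyFactor p.1 p.2) (cauchySeries phi.toRingHom) :=
  hasProd_of_rowSeries (w := fun r => (hSym r : MvPowerSeries ℕ ℤ))
    (fun _ _ _ h => restrictVars_cauchyFactor_of_notMem h) rowSeries_hSym_succ
    (fun r => by
      rw [coeff_hSym, map_zero]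
      exact if_congr eq_comm rfl rfl)
    (fun D N hx _ => coeff_cauchySeries_eq_prod _ phi_uInt D N hx)

theorem hasProd_one_add_xy :
    HasProd (fun p : ℕ × ℕ => 1 + xy p.1 p.2)
      (cauchySeries (phi.toRingHom.comp omega.toRingHom)) :=
  hasProd_of_rowSeries (w := fun r => (eSym r : MvPowerSeries ℕ ℤ))
    (fun S i j h => by rw [map_add, map_one, restrictVars_xy_of_notMem h, add_zero])
    rowSeries_eSym_succ
    (fun r => by
      classical
      rw [coeff_eSym, map_zero]
      exact if_congr (by simp [eq_comm]) rfl rfl)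
    (fun D N hx _ => coeff_cauchySeries_eq_prod _
      (fun r => (congrArg phi (omega_uInt r)).trans (phi_vInt r)) D N hx)

end CauchyIdentities

end SchurCauchy

theorem mainTheorem6 :
    -- the Kostka numbers are the coefficients of the `u_μ` in terms of the `U_λ`
    (∀ mu : YoungDiagram,
      uPart mu = ∑ lam ∈ partitionsOf mu.card, (kostka lam mu : ℤ) • schurU lam) ∧
    -- the `t_μ` satisfy the transition equations that define them
    (∀ lam : YoungDiagram,
      schurU lam = ∑ mu ∈ partitionsOf lam.card, (kostka lam mu : ℤ) • tPart mu) ∧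
    -- the Cauchy identity in `A ⊗ A`, in each degree
    (∀ n : ℕ,
      ∑ lam ∈ partitionsOf n, (schurU lam ⊗ₜ[ℤ] schurU lam : AlgA ⊗[ℤ] AlgA) =
        ∑ lam ∈ partitionsOf n, tPart lam ⊗ₜ[ℤ] uPart lam) ∧
    -- the dual Cauchy identity in `A ⊗ A`, in each degree
    (∀ n : ℕ,
      ∑ lam ∈ partitionsOf n, (schurU lam ⊗ₜ[ℤ] schurV lam : AlgA ⊗[ℤ] AlgA) =
        ∑ lam ∈ partitionsOf n, tPart lam ⊗ₜ[ℤ] vPart lam) ∧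
    -- the Cauchy identity for symmetric functions
    (Multipliable (fun p : ℕ × ℕ => cauchyFactor p.1 p.2) ∧
      HasSum (fun lam : YoungDiagram => inX (sSym lam) * inY (sSym lam))
        (∏' p : ℕ × ℕ, cauchyFactor p.1 p.2) ∧
      HasSum (fun lam : YoungDiagram => inX (mSym lam) * inY (hPart lam))
        (∏' p : ℕ × ℕ, cauchyFactor p.1 p.2)) ∧
    -- the dual Cauchy identity for symmetric functions
    (Multipliable (fun p : ℕ × ℕ => 1 + xy p.1 p.2) ∧
      HasSum (fun lam : YoungDiagram => inX (sSym lam) * inY (sSym lam.transpose))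
        (∏' p : ℕ × ℕ, (1 + xy p.1 p.2)) ∧
      HasSum (fun lam : YoungDiagram => inX (mSym lam) * inY (ePart lam))
        (∏' p : ℕ × ℕ, (1 + xy p.1 p.2))) := by
  refine ⟨uPart_eq_sum_kostka, schurU_eq_sum_tPart, sum_schurU_tmul_schurU,
    sum_schurU_tmul_schurV, ⟨hasProd_cauchyFactor.multipliable, ?_, ?_⟩,
    ⟨hasProd_one_add_xy.multipliable, ?_, ?_⟩⟩
  · rw [hasProd_cauchyFactor.tprod_eq]
    exact hasSum_sSym_mul phi.toRingHom
  · rw [hasProd_cauchyFactor.tprod_eq]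
    convert hasSum_mSym_mul phi.toRingHom using 4 with lam
    exact (phi_uPart lam).symm
  · rw [hasProd_one_add_xy.tprod_eq]
    convert hasSum_sSym_mul (phi.toRingHom.comp omega.toRingHom) using 4 with lam
    exact (phi_schurV lam).symm
  · rw [hasProd_one_add_xy.tprod_eq]
    convert hasSum_mSym_mul (phi.toRingHom.comp omega.toRingHom) using 4 with lam
    exact ((congrArg phi (omega_uPart lam)).trans (phi_vPart lam)).symm
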